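/- Notation. Let $u_{1,q}=q$ and $u_{k+1,q}=u_{k,q}(u_{k,q}+1)$ for $k\ge 1$. A polytope in $\mathbb{R}^d$ is a bounded intersection of finitely many affine half-spaces; a simplex in $\mathbb{R}^d$ is a $d$-dimensional polytope with $d+1$ vertices. A Fano polytope is a polytope $P\subset\mathbb{R}^d$ with $0\in\operatorname{int}(P)$ all of whose vertices are primitive lattice points of $\mathbb{Z}^d$; it is $\epsilon$-lc, for $\epsilon>0$, if $\operatorname{int}(\epsilon P)\cap\mathbb{Z}^d=\{0\}$. The dual of $P$ is $P^*=\{m\in\mathbb{R}^d : \langle m,v\rangle+1\ge 0 \text{ for all } v\in P\}$, and $\operatorname{Vol}(P)=d!\operatorname{vol}(P)$, where $\operatorname{vol}$ is the Euclidean volume. Write $P\simeq Q$ if there is an affine bijection $\phi:\mathbb{R}^d\to\mathbb{R}^d$ with $\phi(\mathbb{Z}^d)=\mathbb{Z}^d$ and $\phi(P)=Q$. Let $e_1,\dots,e_d$ be the standard basis of $\mathbb{R}^d$ and put $$T_{d,q}=\operatorname{conv}\Big(\tfrac{1+u_{1,q}}{q}e_1,\ \dots,\ \tfrac{1+u_{d-1,q}}{q}e_{d-1},\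 -\tfrac{u_{d,q}}{q}e_d,\ \tfrac{u_{d,q}}{q}e_d\Big).$$ Theorem 4.1. Fix integers $d\ge 2$ and $q\ge 1$, and let $S\subset\mathbb{R}^d$ be a $d$-dimensional $\frac1q$-lc Fano simplex. Then: (a) if $d=2$, then $\operatorname{Vol}(S^*)\le 9$ when $q=1$, and $\operatorname{Vol}(S^*)\le \frac{2u_{2,q}^2}{q^3}$ when $q\ge 2$; (b) if $d\ge 3$, then $\operatorname{Vol}(S^*)\le \frac{2u_{d,q}^2}{q^{d+1}}$; (c) let $q\ge 2$. If $S^*\simeq T_{d,q}$, then $\operatorname{Vol}(S^*)=\frac{2u_{d,q}^2}{q^{d+1}}$. Conversely, if $(d,q)\ne(2,2)$ and $\operatorname{Vol}(S^*)=\frac{2u_{d,q}^2}{q^{d+1}}$, then $S^*\simeq T_{d,q}$. -/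

import Mathlib

open scoped Pointwise Nat ENNReal

namespace FanoPolytope

/-- The integers `u_{k,q}`: `u_{1,q} = q` and `u_{k+1,q} = u_{k,q} (u_{k,q} + 1)` for `k ≥ 1`.
The sequence is indexed by `k ≥ 1`; the value at `k = 0` is never used. -/
def u (q : ℕ) : ℕ → ℕ
  | 0 => 0
  | 1 => q
  | (k + 2) => u q (k + 1) * (u q (k + 1) + 1)

/-- The lattice `ℤ^d` inside `ℝ^d`. -/
def lattice (d : ℕ) : Set (Fin d → ℝ) :=
  Set.range fun (z : Fin d → ℤ) (i : Fin d) => (z i : ℝ)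

/-- A polytope: a bounded intersection of finitely many closed affine half-spaces
(convexity is automatic). -/
def IsPolytope {d : ℕ} (P : Set (Fin d → ℝ)) : Prop :=
  Bornology.IsBounded P ∧
    ∃ (n : ℕ) (a : Fin n → Fin d → ℝ) (b : Fin n → ℝ), P = {x | ∀ i, a i ⬝ᵥ x ≤ b i}

/-- The vertices of a polytope: its extreme points. -/
def vert {d : ℕ} (P : Set (Fin d → ℝ)) : Set (Fin d → ℝ) :=
  Set.extremePoints ℝ P

/-- A simplex in `ℝ^d`: a `d`-dimensional polytope with `d + 1` vertices. -/
def IsSimplex {d : ℕ} (S : Set (Fin d → ℝ)) : Prop :=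
  IsPolytope S ∧ affineSpan ℝ S = ⊤ ∧ (vert S).ncard = d + 1

/-- A primitive lattice point: an integer vector whose coordinates have gcd `1`. -/
def IsPrimitive {d : ℕ} (v : Fin d → ℝ) : Prop :=
  ∃ z : Fin d → ℤ, v = (fun i => (z i : ℝ)) ∧ Finset.univ.gcd z = 1

/-- A Fano polytope: a lattice polytope with the origin in its interior, all of whose vertices
are primitive lattice points. -/
def IsFano {d : ℕ} (P : Set (Fin d → ℝ)) : Prop :=
  IsPolytope P ∧ vert P ⊆ lattice d ∧ 0 ∈ interior P ∧ ∀ v ∈ vert P, IsPrimitive v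

/-- An `ε`-lc Fano polytope: a Fano polytope `P` such that the origin is the only lattice point in
the interior of `ε P`. -/
def IsLcFano {d : ℕ} (ε : ℝ) (P : Set (Fin d → ℝ)) : Prop :=
  0 < ε ∧ IsFano P ∧ interior (ε • P) ∩ lattice d = {0}

/-- The dual `P^* = {m | ⟨m, v⟩ + 1 ≥ 0 for all v ∈ P}`. -/
def dual {d : ℕ} (P : Set (Fin d → ℝ)) : Set (Fin d → ℝ) :=
  {m | ∀ v ∈ P, 0 ≤ m ⬝ᵥ v + 1}

/-- The normalized volume `d! * vol(P)`, where `vol` is Lebesgue measure on `ℝ^d`. -/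
noncomputable def normalizedVol {d : ℕ} (P : Set (Fin d → ℝ)) : ℝ≥0∞ :=
  (d ! : ℝ≥0∞) * MeasureTheory.volume P

/-- Unimodular equivalence: some affine bijection `f` of `ℝ^d` with `f(ℤ^d) = ℤ^d` maps `P`
onto `Q`. -/
def UnimodularEquiv {d : ℕ} (P Q : Set (Fin d → ℝ)) : Prop :=
  ∃ f : (Fin d → ℝ) ≃ᵃ[ℝ] (Fin d → ℝ), f '' lattice d = lattice d ∧ f '' P = Q

/-- The convex hull of the points `((1 + u_{i,q}) / q) e_i` for `1 ≤ i ≤ d - 1` and the two points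
`-(u_{d,q} / q) e_d` and `(u_{d,q} / q) e_d`. The basis vector `e_k` is `Pi.single i 1` for the
`i : Fin d` with `i + 1 = k`. -/
noncomputable def extremalSimplex (d q : ℕ) : Set (Fin d → ℝ) :=
  convexHull ℝ
    ({x | ∃ i : Fin d, (i : ℕ) + 1 < d ∧
        x = ((1 + (u q ((i : ℕ) + 1) : ℝ)) / q) • Pi.single i (1 : ℝ)} ∪
      {x | ∃ i : Fin d, (i : ℕ) + 1 = d ∧
        (x = (-((u q d : ℝ) / q)) • Pi.single i (1 : ℝ) ∨
          x = ((u q d : ℝ) / q) • Pi.single i (1 : ℝ))})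

end FanoPolytope

/-! Let `b 0 ≥ ... ≥ b d > 0` be the barycentric coordinates of the origin with respect to the
vertices of `S`. In the coordinates `⟨m, v i⟩ + 1`, `i < d`, the dual becomes a corner simplex, so
its normalized volume is `1 / (b 0 ⋯ b (d-1) * |D|)`, where `D` is the determinant of the first `d`
vertices, a nonzero integer. It remains to bound `b 0 ⋯ b (d-1)` from below.

The lc condition enters through Minkowski's theorem (`prod_le_of_lc`): for each `j < d`, the product
of the first `j` coordinates is at most `q ^ j` times the sum of the others. These inequalities,
monotonicity and positivity are all that `prod_ge` uses.

The reference sequence is `y i = q / (1 + u_{i+1,q})`, whose partial products and sums telescope. If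
`b 0 ⋯ b (d-1)` were too small, take the last `j < d` for which the product of the first `j` terms
of `b` is at least that of `y`. Beyond `j` the partial products of `b` fall below those of `y`,
which forces the tail sum of `b` from `j` down to `q / u_{j+1,q}` (`tail_sum_le`), while the lc
inequality at `j` pushes it up to that value. The comparison uses `b * log (y / b) ≤ y - b`, Abel
summation, and a final block replaced by its geometric mean; there it reduces to `U ^ (n+1) * (n+1)
^ n ≤ 2 * u_{n,U} ^ 2`.

For `q ≥ 2` and `(d, q) ≠ (2, 2)`, equality fixes every `b i` and makes `|D| = 1`, so the dual is
unimodularly a specific corner simplex, which a shear carries to `T_{d,q}`. The pair `(2, 1)`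
violates the numerical inequality and is treated by hand. -/

namespace FanoPolytope

/-! ### Growth of the sequence `u` -/

theorem u_succ (q : ℕ) {k : ℕ} (hk : 1 ≤ k) : u q (k + 1) = u q k * (u q k + 1) := by
  obtain ⟨k, rfl⟩ := Nat.exists_eq_add_of_le' hk
  rfl

theorem u_pos {q : ℕ} (hq : 1 ≤ q) {k : ℕ} (hk : 1 ≤ k) : 1 ≤ u q k := by
  induction k, hk using Nat.le_induction with
  | base => exact hq
  | succ k hk ih => rw [u_succ q hk]; nlinarith

/-- The recursion does not see its index, so a tail of the sequence is again such a sequence. This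
turns estimates on a final block of indices into estimates starting from `U = u q (m + 1)`. -/
theorem u_add (q m : ℕ) {n : ℕ} (hn : 1 ≤ n) : u q (m + n) = u (u q (m + 1)) n := by
  induction n, hn using Nat.le_induction with
  | base => rfl
  | succ n hn ih => rw [← add_assoc, u_succ q (by omega), u_succ _ hn, ih]

theorem mul_le_u (q : ℕ) (hq : 1 ≤ q) {n : ℕ} (hn : 1 ≤ n) : n * q ≤ u q n := by
  induction n, hn using Nat.le_induction with
  | base => simp [u]
  | succ n hn ih =>
    rw [u_succ q hn]
    have h1 : 1 ≤ n * q := Nat.mul_pos hn hq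
    have h2 : (n + 1) * q ≤ n * q * (n * q + 1) := by nlinarith
    exact h2.trans (Nat.mul_le_mul ih (by omega))

/-- A consequence of `(1 + 1 / (n + 1)) ^ n < 3`. -/
theorem succ_succ_pow_lt (n : ℕ) : ((n : ℝ) + 2) ^ n < 3 * (n + 1) ^ n := by
  have h0 : (0 : ℝ) < n + 1 := by positivity
  have h1 : ((n : ℝ) + 2) ≤ (n + 1) * Real.exp (1 / (n + 1)) := by
    have := Real.add_one_le_exp (1 / ((n : ℝ) + 1))
    calc ((n : ℝ) + 2) = (n + 1) * (1 / (n + 1) + 1) := by field_simp; ring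
      _ ≤ _ := by gcongr
  calc ((n : ℝ) + 2) ^ n ≤ ((n + 1) * Real.exp (1 / (n + 1))) ^ n := by gcongr
    _ = (n + 1) ^ n * Real.exp (n * (1 / (n + 1))) := by rw [mul_pow, Real.exp_nat_mul]
    _ ≤ (n + 1) ^ n * Real.exp 1 := by
      gcongr
      rw [mul_one_div, div_le_one h0]; linarith
    _ < (n + 1) ^ n * 3 := by
      gcongr
      exact Real.exp_one_lt_d9.trans (by norm_num)
    _ = _ := by ring

/-- Passing from `n` to `n + 1` multiplies the right side by `(u U n + 1) ^ 2` and the left side by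
less than `3 * (n + 2) * U`; the bound `n * U ≤ u U n` compares the two factors. For `n = 2` this
needs `U ≥ 2`, which is what `hUn` says there. -/
theorem pow_mul_lt_two_mul_u_sq_succ {U n : ℕ} (hU : 1 ≤ U) (hn : 2 ≤ n)
    (hUn : 12 ≤ n * n * U + 2 * n ∨ 3 ≤ n)
    (h : (U : ℝ) ^ (n + 1) * (n + 1) ^ n ≤ 2 * (u U n : ℝ) ^ 2) :
    (U : ℝ) ^ (n + 2) * (n + 2) ^ (n + 1) < 2 * (u U (n + 1) : ℝ) ^ 2 := by
  have hU' : (1 : ℝ) ≤ U := by exact_mod_cast hU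
  have hn' : (2 : ℝ) ≤ n := by exact_mod_cast hn
  have h1 : (n : ℝ) * U ≤ u U n := by exact_mod_cast mul_le_u U hU (by omega)
  have h2 : 3 * ((n : ℝ) + 2) * U ≤ ((u U n : ℝ) + 1) ^ 2 := by
    have h3 : ((n : ℝ) * U + 1) ^ 2 ≤ ((u U n : ℝ) + 1) ^ 2 := by gcongr
    refine le_trans ?_ h3
    rcases Nat.lt_or_ge n 3 with h4 | h4
    · have : n = 2 := by omega
      subst this
      have h5 : 2 ≤ U := by omega
      have h5 : (2 : ℝ) ≤ U := by exact_mod_cast h5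
      push_cast
      nlinarith
    · have h4 : (3 : ℝ) ≤ n := by exact_mod_cast h4
      nlinarith [mul_nonneg (sub_nonneg.2 h4) (sub_nonneg.2 hU'),
        mul_nonneg (sub_nonneg.2 h4) (mul_nonneg (sub_nonneg.2 h4) (sub_nonneg.2 hU')),
        mul_nonneg (sub_nonneg.2 hU') (sub_nonneg.2 hU'),
        mul_nonneg (sub_nonneg.2 h4) (mul_nonneg (sub_nonneg.2 hU') (sub_nonneg.2 hU'))]
  have hs : (u U (n + 1) : ℝ) = u U n * (u U n + 1) := by
    rw [u_succ U (by omega)]; push_cast; rfl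
  calc (U : ℝ) ^ (n + 2) * (n + 2) ^ (n + 1)
      = U ^ (n + 1) * (n + 2) ^ n * ((n + 2) * U) := by ring
    _ < U ^ (n + 1) * (3 * (n + 1) ^ n) * ((n + 2) * U) := by
      gcongr; exact succ_succ_pow_lt n
    _ = (U ^ (n + 1) * (n + 1) ^ n) * (3 * (n + 2) * U) := by ring
    _ ≤ (2 * (u U n : ℝ) ^ 2) * ((u U n : ℝ) + 1) ^ 2 := by gcongr
    _ = _ := by rw [hs]; ring

theorem pow_mul_le_two_mul_u_sq_two {U : ℕ} (hU : 2 ≤ U) :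
    (U : ℝ) ^ 3 * 3 ^ 2 ≤ 2 * (u U 2 : ℝ) ^ 2 ∧
      (3 ≤ U → (U : ℝ) ^ 3 * 3 ^ 2 < 2 * (u U 2 : ℝ) ^ 2) := by
  have hs : (u U 2 : ℝ) = U * (U + 1) := by simp [u]
  have hU' : (2 : ℝ) ≤ U := by exact_mod_cast hU
  rw [hs]
  have key : 2 * ((U : ℝ) * (U + 1)) ^ 2 - U ^ 3 * 3 ^ 2 = U ^ 2 * ((2 * U - 1) * (U - 2)) := by ring
  refine ⟨?_, fun h => ?_⟩
  · have : 0 ≤ (U : ℝ) ^ 2 * ((2 * U - 1) * (U - 2)) :=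
      mul_nonneg (by positivity) (mul_nonneg (by linarith) (by linarith))
    linarith
  · have h : (3 : ℝ) ≤ U := by exact_mod_cast h
    have : 0 < (U : ℝ) ^ 2 * ((2 * U - 1) * (U - 2)) :=
      mul_pos (by positivity) (mul_pos (by linarith) (by linarith))
    linarith

theorem pow_mul_lt_two_mul_u_sq {U n : ℕ} (hU : 1 ≤ U) (hn : 3 ≤ n) :
    (U : ℝ) ^ (n + 1) * (n + 1) ^ n < 2 * (u U n : ℝ) ^ 2 := by
  induction n, hn using Nat.le_induction with
  | base =>
    rcases Nat.lt_or_ge U 2 with h | h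
    · obtain rfl : U = 1 := by omega
      norm_num [u]
    · have := pow_mul_lt_two_mul_u_sq_succ hU le_rfl (by omega)
        (by have h9 := (pow_mul_le_two_mul_u_sq_two h).1; norm_num at h9 ⊢; exact h9)
      norm_num at this ⊢
      exact this
  | succ n hn ih =>
    have := pow_mul_lt_two_mul_u_sq_succ hU (by omega) (Or.inr hn) ih.le
    push_cast
    convert this using 2
    ring

/-- The case `U = 1`, `n = 2` is a true exception (`9 > 8`). Equality holds for `n = 1`, and for `U
= n = 2` (`72 = 72`); the latter is the source of the exception `(d, q) = (2, 2)` to uniqueness. -/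
theorem pow_mul_le_two_mul_u_sq {U n : ℕ} (hU : 1 ≤ U) (hn : 1 ≤ n) (h : ¬ (U = 1 ∧ n = 2)) :
    (U : ℝ) ^ (n + 1) * (n + 1) ^ n ≤ 2 * (u U n : ℝ) ^ 2 ∧
      (2 ≤ n → ¬ (U = 2 ∧ n = 2) → (U : ℝ) ^ (n + 1) * (n + 1) ^ n < 2 * (u U n : ℝ) ^ 2) := by
  rcases Nat.lt_or_ge n 3 with h3 | h3
  · rcases Nat.lt_or_ge n 2 with h2 | h2
    · obtain rfl : n = 1 := by omega
      refine ⟨le_of_eq ?_, fun h => by omega⟩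
      simp [u]; ring
    · obtain rfl : n = 2 := by omega
      have := pow_mul_le_two_mul_u_sq_two (U := U) (by omega)
      norm_num at this ⊢
      refine ⟨this.1, fun h' => this.2 (by omega)⟩
  · exact ⟨(pow_mul_lt_two_mul_u_sq hU h3).le, fun _ _ => pow_mul_lt_two_mul_u_sq hU h3⟩

/-! ### Comparing a decreasing sequence with a reference sequence -/

/-- Abel summation against a decreasing sequence of weights. -/
theorem mul_sum_Ico_le_sum_Ico_mul {b l : ℕ → ℝ} (hb : Antitone b) {j m : ℕ} (hjm : j ≤ m)
    (hl : ∀ k, j ≤ k → k ≤ m → 0 ≤ ∑ i ∈ Finset.Ico j k, l i) {c : ℝ}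
    (hc : ∀ i, j ≤ i → i < m → c ≤ b i) :
    c * ∑ i ∈ Finset.Ico j m, l i ≤ ∑ i ∈ Finset.Ico j m, b i * l i := by
  induction m, hjm using Nat.le_induction generalizing c with
  | base => simp
  | succ m hjm ih =>
    have h1 := ih (fun k h h' => hl k h (by omega)) (c := b m) (fun i _ h => hb h.le)
    have h2 := mul_le_mul_of_nonneg_right (hc m hjm (by omega)) (hl (m + 1) (by omega) le_rfl)
    rw [Finset.sum_Ico_succ_top hjm] at h2 ⊢
    rw [Finset.sum_Ico_succ_top hjm]
    linarith

theorem mul_log_div_le_sub {x y : ℝ} (hx : 0 < x) (hy : 0 < y) :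
    x * Real.log (y / x) ≤ y - x ∧ (x * Real.log (y / x) = y - x → y = x) := by
  have h0 : 0 < y / x := div_pos hy hx
  have h2 : x * (y / x - 1) = y - x := by field_simp
  refine ⟨?_, fun h => ?_⟩
  · rw [← h2]
    gcongr
    exact Real.log_le_sub_one_of_pos h0
  · by_contra hne
    have h3 := Real.log_lt_sub_one_of_pos h0 (fun h => hne ((div_eq_one_iff_eq hx.ne').1 h))
    have := mul_lt_mul_of_pos_left h3 hx
    linarith

theorem exists_pow_eq {x : ℝ} (hx : 0 < x) {n : ℕ} (hn : n ≠ 0) : ∃ g : ℝ, 0 < g ∧ g ^ n = x :=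
  ⟨x ^ (1 / (n : ℝ)), by positivity, by
    rw [← Real.rpow_natCast, ← Real.rpow_mul hx.le, one_div_mul_cancel (by positivity),
      Real.rpow_one]⟩

/-- The sum of the last terms, with the last one counted twice, can be compared with
their geometric mean, after moving the starting point down suitably. -/
theorem exists_pooled_block {b : ℕ → ℝ} (hb : Antitone b) (hpos : ∀ i, 0 < b i) (j t : ℕ) :
    ∃ m n : ℕ, j ≤ m ∧ 1 ≤ n ∧ m + n = j + t + 1 ∧ ∃ g : ℝ, 0 < g ∧
      g ^ n = ∏ i ∈ Finset.Ico m (j + t + 1), b i ∧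
      ∑ i ∈ Finset.Ico m (j + t + 1), b i + b (j + t) ≤ (n + 1) * g ∧
      ∀ i, j ≤ i → i < m → (n + 1) * g / n ≤ b i := by
  induction t generalizing j with
  | zero =>
    refine ⟨j, 1, le_rfl, le_rfl, rfl, b j, hpos j, by simp, ?_, fun i h h' => by omega⟩
    simp; linarith
  | succ t ih =>
    obtain ⟨m, n, hm, hn, hmn, g, hg, hgn, hsum, hc⟩ := ih (j + 1)
    have hn' : (1 : ℝ) ≤ n := by exact_mod_cast hn
    rw [show j + 1 + t = j + (t + 1) by ring] at *
    -- The threshold `(n + 1) * g / n` is the derivative of `(n + 1) * g` with respect to the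
    -- logarithm of the block's product `g ^ n`. A term below it is absorbed into the block.
    by_cases hj : (n + 1) * g / n ≤ b j
    · exact ⟨m, n, by omega, hn, hmn, g, hg, hgn, hsum, fun i hi hi' =>
        (eq_or_lt_of_le hi).elim (fun h => h ▸ hj) (fun h => hc i h hi')⟩
    · push Not at hj
      obtain rfl : m = j + 1 := by
        by_contra hne
        have := (hc (j + 1) le_rfl (by omega)).trans (hb (Nat.le_succ j))
        linarith
      have hgb : g ≤ b j := by
        refine le_of_pow_le_pow_left₀ (n := n) (by omega) (hpos j).le ?_
        rw [hgn]
        calc ∏ i ∈ Finset.Ico (j + 1) (j + (t + 1) + 1), b i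
            ≤ ∏ i ∈ Finset.Ico (j + 1) (j + (t + 1) + 1), b j := by
              refine Finset.prod_le_prod (fun i _ => (hpos i).le) (fun i hi => hb ?_)
              rw [Finset.mem_Ico] at hi; omega
          _ = b j ^ n := by
              rw [Finset.prod_const, Nat.card_Ico]; congr 1; omega
      have hpr : 0 < b j * g ^ n := by have := hpos j; positivity
      obtain ⟨G, hG, hGn⟩ := exists_pow_eq hpr (Nat.succ_ne_zero n)
      refine ⟨j, n + 1, le_rfl, by omega, by omega, G, hG, ?_, ?_, fun i h h' => by omega⟩
      · rw [hGn, hgn, ← Finset.prod_eq_prod_Ico_succ_bot (by omega)]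
      · rw [Finset.sum_eq_sum_Ico_succ_bot (by omega)]
        -- With `x = b j` and `s = x + (n + 1) * g`, Bernoulli applied to `(n + 2) * g / s = 1 - (x
        -- - g) / s` leaves `1 - (n + 1) * (x - g) / s ≥ g / x`, which amounts to `((n + 1) * g - n
        -- * x) * (x - g) ≥ 0`, that is, `x` lies between `g` and the threshold.
        have key : b j + (n + 1) * g ≤ (n + 2) * G := by
          refine le_of_pow_le_pow_left₀ (n := n + 1) (by omega) (by positivity) ?_
          rw [mul_pow, hGn]
          set x := b j with hx
          have hx0 : 0 < x := hpos j
          have hs : 0 < x + (n + 1) * g := by positivity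
          have hbern := one_add_mul_le_pow (a := -((x - g) / (x + (n + 1) * g))) (by
            rw [neg_le_neg_iff, div_le_iff₀ hs]; nlinarith) (n + 1)
          have h1 : 1 + -((x - g) / (x + (n + 1) * g)) = (n + 2) * g / (x + (n + 1) * g) := by
            field_simp; ring
          rw [h1, div_pow, le_div_iff₀ (by positivity)] at hbern
          have h2 : g / x ≤ 1 + ((n + 1 : ℕ) : ℝ) * -((x - g) / (x + (n + 1) * g)) := by
            have h3 : 0 ≤ ((n + 1) * g - n * x) * (x - g) := by
              refine mul_nonneg ?_ (by linarith)
              rw [lt_div_iff₀ (by positivity)] at hj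
              nlinarith
            have h4 : 1 + ((n + 1 : ℕ) : ℝ) * -((x - g) / (x + (n + 1) * g)) - g / x
                = (((n + 1) * g - n * x) * (x - g)) / (x * (x + (n + 1) * g)) := by
              push_cast; field_simp; ring
            have := div_nonneg h3 (by positivity : 0 ≤ x * (x + (n + 1) * g))
            linarith
          have h5 : g / x * (x + (n + 1) * g) ^ (n + 1) ≤ ((n + 2) * g) ^ (n + 1) :=
            (mul_le_mul_of_nonneg_right h2 (by positivity)).trans hbern
          rw [div_mul_eq_mul_div, div_le_iff₀ hx0, mul_pow] at h5
          refine le_of_mul_le_mul_left ?_ hg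
          calc _ ≤ _ := h5
            _ = _ := by ring
        push_cast
        linarith

/-- Sum `b i * log (y i / b i) ≤ y i - b i`. Since the partial sums of the logarithms are
nonnegative and `b` decreases, Abel summation replaces the weights `b i` by their lower bound `c`.
Equality makes each logarithmic inequality sharp. -/
theorem mul_log_prod_div_le_sum_sub {b y : ℕ → ℝ} (hb : Antitone b) (hpos : ∀ i, 0 < b i)
    (hy : ∀ i, 0 < y i) {j m : ℕ} (hjm : j ≤ m)
    (hprod : ∀ k, j ≤ k → k ≤ m → ∏ i ∈ Finset.Ico j k, b i ≤ ∏ i ∈ Finset.Ico j k, y i) {c : ℝ}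
    (hc : ∀ i, j ≤ i → i < m → c ≤ b i) :
    c * Real.log ((∏ i ∈ Finset.Ico j m, y i) / ∏ i ∈ Finset.Ico j m, b i) ≤
        ∑ i ∈ Finset.Ico j m, y i - ∑ i ∈ Finset.Ico j m, b i ∧
      (c * Real.log ((∏ i ∈ Finset.Ico j m, y i) / ∏ i ∈ Finset.Ico j m, b i) =
        ∑ i ∈ Finset.Ico j m, y i - ∑ i ∈ Finset.Ico j m, b i →
          ∀ i, j ≤ i → i < m → y i = b i) := by
  have hlog (k : ℕ) : ∑ i ∈ Finset.Ico j k, Real.log (y i / b i) =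
      Real.log ((∏ i ∈ Finset.Ico j k, y i) / ∏ i ∈ Finset.Ico j k, b i) := by
    rw [← Finset.prod_div_distrib, Real.log_prod]
    exact fun i _ => (div_pos (hy i) (hpos i)).ne'
  have h1 := mul_sum_Ico_le_sum_Ico_mul hb hjm (l := fun i => Real.log (y i / b i))
    (fun k hk hk' => by
      rw [hlog]
      refine Real.log_nonneg ((one_le_div (Finset.prod_pos fun i _ => hpos i)).2 (hprod k hk hk')))
    hc
  rw [hlog] at h1
  have h2 : ∀ i ∈ Finset.Ico j m, b i * Real.log (y i / b i) ≤ y i - b i :=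
    fun i _ => (mul_log_div_le_sub (hpos i) (hy i)).1
  have h3 := Finset.sum_le_sum h2
  rw [Finset.sum_sub_distrib] at h3
  refine ⟨h1.trans h3, fun h i hi hi' => ?_⟩
  have h4 : ∑ i ∈ Finset.Ico j m, b i * Real.log (y i / b i) =
      ∑ i ∈ Finset.Ico j m, (y i - b i) := by
    rw [Finset.sum_sub_distrib]; linarith
  exact (mul_log_div_le_sub (hpos i) (hy i)).2
    ((Finset.sum_eq_sum_iff_of_le h2).1 h4 i (Finset.mem_Ico.2 ⟨hi, hi'⟩))

/-! ### Sylvester weights and the bound on the product -/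

/-- The barycentric coordinates `q / (1 + u_{i+1,q})` of the extremal simplex. -/
noncomputable def sylvesterWeight (q i : ℕ) : ℝ := q / (1 + u q (i + 1))

theorem sylvesterWeight_pos {q : ℕ} (hq : 1 ≤ q) (i : ℕ) : 0 < sylvesterWeight q i := by
  have : (0 : ℝ) < q := by exact_mod_cast hq
  unfold sylvesterWeight; positivity

theorem u_cast_pos {q : ℕ} (hq : 1 ≤ q) {k : ℕ} (hk : 1 ≤ k) : (0 : ℝ) < u q k := by
  exact_mod_cast u_pos hq hk

theorem u_cast_succ (q : ℕ) {k : ℕ} (hk : 1 ≤ k) : (u q (k + 1) : ℝ) = u q k * (1 + u q k) := by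
  rw [u_succ q hk]; push_cast; ring

theorem sum_sylvesterWeight {q : ℕ} (hq : 1 ≤ q) {j k : ℕ} (hjk : j ≤ k) :
    ∑ i ∈ Finset.Ico j k, sylvesterWeight q i = q / u q (j + 1) - q / u q (k + 1) := by
  induction k, hjk using Nat.le_induction with
  | base => simp
  | succ k hjk ih =>
    rw [Finset.sum_Ico_succ_top hjk, ih, sylvesterWeight, u_cast_succ q (by omega : 1 ≤ k + 1)]
    have := u_cast_pos hq (by omega : 1 ≤ k + 1)
    have := u_cast_pos hq (by omega : 1 ≤ j + 1)
    field_simp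
    ring

theorem prod_sylvesterWeight {q : ℕ} (hq : 1 ≤ q) {j k : ℕ} (hjk : j ≤ k) :
    ∏ i ∈ Finset.Ico j k, sylvesterWeight q i = q ^ (k - j) * u q (j + 1) / u q (k + 1) := by
  induction k, hjk using Nat.le_induction with
  | base => have := u_cast_pos hq (by omega : 1 ≤ j + 1); simp; field_simp
  | succ k hjk ih =>
    rw [Finset.prod_Ico_succ_top hjk, ih, sylvesterWeight, u_cast_succ q (by omega : 1 ≤ k + 1),
      Nat.succ_sub hjk, pow_succ]
    have := u_cast_pos hq (by omega : 1 ≤ k + 1)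
    field_simp

theorem prod_range_sylvesterWeight {q : ℕ} (hq : 1 ≤ q) (k : ℕ) :
    ∏ i ∈ Finset.range k, sylvesterWeight q i = q ^ (k + 1) / u q (k + 1) := by
  rw [Finset.range_eq_Ico, prod_sylvesterWeight hq (Nat.zero_le _)]
  simp [u, pow_succ]

/-- The competitor to `b` on `[j, d]` consists of the Sylvester weights up to `m`, then `n` equal
terms `G` with the last one counted twice, where `G` is chosen to reach the target product. Its sum
is at most `q / u q (j + 1)`, and having the larger product it has the larger sum. -/
theorem tail_sum_le {q d : ℕ} (hq : 1 ≤ q) (hdq : ¬ (d = 2 ∧ q = 1)) {b : ℕ → ℝ} (hb : Antitone b)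
    (hpos : ∀ i, 0 < b i) {j : ℕ} (hjd : j < d)
    (hj : (q : ℝ) ^ (j + 1) / u q (j + 1) ≤ ∏ i ∈ Finset.range j, b i)
    (hk : ∀ k, j < k → k < d → ∏ i ∈ Finset.range k, b i < (q : ℝ) ^ (k + 1) / u q (k + 1))
    (hP : ∏ i ∈ Finset.range d, b i ≤ (q : ℝ) ^ (d + 1) / (2 * (u q d : ℝ) ^ 2)) :
    ∑ i ∈ Finset.Ico j (d + 1), b i ≤ q / u q (j + 1) ∧
      (∑ i ∈ Finset.Ico j (d + 1), b i = q / u q (j + 1) →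
        ∏ i ∈ Finset.range d, b i = (q : ℝ) ^ (d + 1) / (2 * (u q d : ℝ) ^ 2) ∧
          (j + 1 = d ∨ u q (j + 1) = 2 ∧ j + 2 = d)) := by
  -- The block ends at `d - 1`; counting `b (d - 1)` twice makes room for `b d ≤ b (d - 1)`.
  obtain ⟨m, n, hjm, hn, hmn, g, hg, hgn, hsum, hc⟩ := exists_pooled_block hb hpos j (d - j - 1)
  have hd1 : j + (d - j - 1) + 1 = d := by omega
  rw [hd1] at hmn hgn hsum
  have hq0 : (0 : ℝ) < q := by exact_mod_cast hq
  have hn0 : (0 : ℝ) < n := by exact_mod_cast hn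
  have hUj := u_cast_pos hq (by omega : 1 ≤ j + 1)
  have hUm := u_cast_pos hq (by omega : 1 ≤ m + 1)
  have hUd := u_cast_pos hq (by omega : 1 ≤ d)
  have hIco (k : ℕ) (h : j ≤ k) :
      (∏ i ∈ Finset.range j, b i) * ∏ i ∈ Finset.Ico j k, b i = ∏ i ∈ Finset.range k, b i :=
    Finset.prod_range_mul_prod_Ico _ h
  have hIcoY (k : ℕ) (h : j ≤ k) : (q : ℝ) ^ (j + 1) / u q (j + 1) *
      ∏ i ∈ Finset.Ico j k, sylvesterWeight q i = (q : ℝ) ^ (k + 1) / u q (k + 1) := by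
    rw [← prod_range_sylvesterWeight hq, ← prod_range_sylvesterWeight hq]
    exact Finset.prod_range_mul_prod_Ico _ h
  have hYj : 0 < (q : ℝ) ^ (j + 1) / u q (j + 1) := by positivity
  obtain ⟨h1, h1'⟩ := mul_log_prod_div_le_sum_sub hb hpos (sylvesterWeight_pos hq) hjm
    (fun k hjk hkm => by
      rcases eq_or_lt_of_le hjk with rfl | hlt
      · simp
      · refine le_of_mul_le_mul_left ?_ hYj
        rw [hIcoY k hjk]
        refine le_trans ?_ (hk k hlt (by omega)).le
        rw [← hIco k hjk]
        exact mul_le_mul_of_nonneg_right hj (Finset.prod_nonneg fun i _ => (hpos i).le)) hc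
  rw [sum_sylvesterWeight hq hjm] at h1 h1'
  set c := ((n : ℝ) + 1) * g / n with hcdef
  have hc0 : 0 < c := by positivity
  set A := ∏ i ∈ Finset.Ico j m, sylvesterWeight q i with hA
  set B := ∏ i ∈ Finset.Ico j m, b i with hB
  have hA0 : 0 < A := Finset.prod_pos fun i _ => sylvesterWeight_pos hq i
  have hB0 : 0 < B := Finset.prod_pos fun i _ => hpos i
  have hud : u q d = u (u q (m + 1)) n := by rw [← hmn, u_add q m hn]
  obtain ⟨G, hG, hGn⟩ := exists_pow_eq (x := (q : ℝ) ^ n * u q (m + 1) / (2 * (u q d : ℝ) ^ 2))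
    (by positivity) (by omega : n ≠ 0)
  -- The value `1` occurs only as `u 1 1`, so the numerical exception is exactly `d = 2`, `q = 1`.
  have hex : ¬ (u q (m + 1) = 1 ∧ n = 2) := by
    rintro ⟨h, rfl⟩
    have h5 := mul_le_u q hq (by omega : 1 ≤ m + 1)
    rw [h] at h5
    have : m = 0 := by nlinarith
    subst this
    exact hdq ⟨by omega, by omega⟩
  obtain ⟨hu1, hu2⟩ := pow_mul_le_two_mul_u_sq (u_pos hq (by omega : 1 ≤ m + 1)) hn hex
  rw [← hud] at hu1 hu2
  have hGpow : (((n : ℝ) + 1) * G) ^ n =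
      ((u q (m + 1) : ℝ) ^ (n + 1) * (n + 1) ^ n) / (2 * (u q d : ℝ) ^ 2) *
        (q / u q (m + 1)) ^ n := by
    rw [mul_pow, hGn, div_pow]; field_simp; ring
  have hG1 : ((n : ℝ) + 1) * G ≤ q / u q (m + 1) := by
    refine le_of_pow_le_pow_left₀ (n := n) (by omega) (by positivity) ?_
    rw [hGpow]
    exact mul_le_of_le_one_left (by positivity) ((div_le_one (by positivity)).2 hu1)
  have hG2 : 2 ≤ n → ¬ (u q (m + 1) = 2 ∧ n = 2) → ((n : ℝ) + 1) * G < q / u q (m + 1) := by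
    intro h h'
    refine lt_of_pow_lt_pow_left₀ n (by positivity) ?_
    rw [hGpow]
    exact mul_lt_of_lt_one_left (by positivity) ((div_lt_one (by positivity)).2 (hu2 h h'))
  -- The weight `c` is tuned so that the block obeys the logarithmic inequality with the same weight
  -- as the terms before it; the two logarithms then merge into that of the whole product.
  have h2 : c * Real.log (G ^ n / g ^ n) ≤ (n + 1) * G - (n + 1) * g := by
    rw [← div_pow, Real.log_pow, hcdef]
    have := mul_le_mul_of_nonneg_left (mul_log_div_le_sub hg hG).1 (by positivity : 0 ≤ (n : ℝ) + 1)
    calc _ = ((n : ℝ) + 1) * (g * Real.log (G / g)) := by field_simp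
      _ ≤ _ := this
      _ = _ := by ring
  have hlog : c * Real.log (A / B) + c * Real.log (G ^ n / g ^ n) =
      c * Real.log ((A * G ^ n) / (B * g ^ n)) := by
    rw [← mul_add, ← Real.log_mul (by positivity) (by positivity)]
    congr 2; field_simp
  have hAG : (q : ℝ) ^ (j + 1) / u q (j + 1) * (A * G ^ n) =
      (q : ℝ) ^ (d + 1) / (2 * (u q d : ℝ) ^ 2) := by
    rw [← mul_assoc, hIcoY m hjm, hGn, ← hmn]
    field_simp; ring
  have hBg : (∏ i ∈ Finset.range j, b i) * (B * g ^ n) = ∏ i ∈ Finset.range d, b i := by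
    rw [hgn, Finset.prod_Ico_consecutive _ hjm (by omega), hIco d hjd.le]
  have hBg0 : 0 < B * g ^ n := by positivity
  have hcmp : (q : ℝ) ^ (j + 1) / u q (j + 1) * (B * g ^ n) ≤ ∏ i ∈ Finset.range d, b i := by
    rw [← hBg]; exact mul_le_mul_of_nonneg_right hj hBg0.le
  have hlog0 : 0 ≤ c * Real.log ((A * G ^ n) / (B * g ^ n)) := by
    refine mul_nonneg hc0.le (Real.log_nonneg ((one_le_div hBg0).2 ?_))
    refine le_of_mul_le_mul_left ?_ hYj
    rw [hAG]; exact hcmp.trans hP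
  have hlog1 : ∏ i ∈ Finset.range d, b i < (q : ℝ) ^ (d + 1) / (2 * (u q d : ℝ) ^ 2) →
      0 < c * Real.log ((A * G ^ n) / (B * g ^ n)) := by
    intro h
    refine mul_pos hc0 (Real.log_pos ((one_lt_div hBg0).2 ?_))
    refine lt_of_mul_lt_mul_left ?_ hYj.le
    rw [hAG]; exact hcmp.trans_lt h
  have hσ : ∑ i ∈ Finset.Ico j (d + 1), b i ≤ ∑ i ∈ Finset.Ico j m, b i + (n + 1) * g := by
    rw [Finset.sum_Ico_succ_top hjd.le, ← Finset.sum_Ico_consecutive _ hjm (by omega : m ≤ d)]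
    have := hb (by omega : j + (d - j - 1) ≤ d)
    linarith
  refine ⟨by linarith, fun heq => ?_⟩
  have hPd : ∏ i ∈ Finset.range d, b i = (q : ℝ) ^ (d + 1) / (2 * (u q d : ℝ) ^ 2) := by
    refine hP.antisymm (not_lt.1 fun h => ?_)
    have := hlog1 h
    linarith
  refine ⟨hPd, ?_⟩
  have hyb := h1' (by linarith)
  -- Otherwise `b j` equals its Sylvester weight, so `j + 1` would satisfy the product inequality
  -- too, against `hk`.
  obtain rfl : j = m := by
    by_contra hne
    have h5 := hyb j le_rfl (by omega)
    have h6 := hk (j + 1) (by omega) (by omega)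
    rw [← hIcoY (j + 1) (by omega), Finset.prod_range_succ] at h6
    simp only [Nat.Ico_succ_singleton, Finset.prod_singleton, h5] at h6
    exact absurd hj (not_le.2 (lt_of_mul_lt_mul_right h6 (hpos j).le))
  by_contra hne
  have := hG2 (by omega) (fun h => hne (Or.inr ⟨h.1, by omega⟩))
  linarith

theorem exists_max_of_zero {p : ℕ → Prop} (h0 : p 0) {d : ℕ} (hd : 0 < d) :
    ∃ j < d, p j ∧ ∀ k, j < k → k < d → ¬ p k := by
  classical
  have h1 := Nat.findGreatest_spec (Nat.zero_le (d - 1)) h0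
  have h2 := Nat.findGreatest_le (P := p) (d - 1)
  exact ⟨_, by omega, h1, fun k hk hkd => Nat.findGreatest_is_greatest hk (by omega)⟩

/-- The product-sum inequalities for the coordinates bound the product of the largest ones from
below. -/
theorem prod_ge {q d : ℕ} (hq : 1 ≤ q) (hd : 1 ≤ d) (hdq : ¬ (d = 2 ∧ q = 1)) {b : ℕ → ℝ}
    (hb : Antitone b) (hpos : ∀ i, 0 < b i)
    (hC : ∀ j < d, ∏ i ∈ Finset.range j, b i ≤ (q : ℝ) ^ j * ∑ i ∈ Finset.Ico j (d + 1), b i) :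
    (q : ℝ) ^ (d + 1) / (2 * (u q d : ℝ) ^ 2) ≤ ∏ i ∈ Finset.range d, b i := by
  have hq0 : (0 : ℝ) < q := by exact_mod_cast hq
  by_contra! hlt
  obtain ⟨j, hjd, hj, hk⟩ := exists_max_of_zero
    (p := fun j => (q : ℝ) ^ (j + 1) / u q (j + 1) ≤ ∏ i ∈ Finset.range j, b i)
    (by simp [u]; field_simp; exact le_rfl) hd
  obtain ⟨h1, h2⟩ := tail_sum_le hq hdq hb hpos hjd hj (fun k h h' => not_le.1 (hk k h h')) hlt.le
  have h3 := hj.trans (hC j hjd)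
  rw [pow_succ, mul_div_assoc] at h3
  exact hlt.ne (h2 (h1.antisymm (le_of_mul_le_mul_left h3 (by positivity)))).1

/-- Equality is propagated downwards from `k = d - 1` to `k = 0`: products of the first `k` terms
and sums of the remaining ones agree with the reference values, and this determines `b k`. For `q ≥
2`, the second equality case of `tail_sum_le` occurs only at `(d, q) = (2, 2)`. -/
theorem eq_of_prod_eq {q d : ℕ} (hq : 2 ≤ q) (hd : 1 ≤ d) (hdq : ¬ (d = 2 ∧ q = 2)) {b : ℕ → ℝ}
    (hb : Antitone b) (hpos : ∀ i, 0 < b i)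
    (hC : ∀ j < d, ∏ i ∈ Finset.range j, b i ≤ (q : ℝ) ^ j * ∑ i ∈ Finset.Ico j (d + 1), b i)
    (heq : ∏ i ∈ Finset.range d, b i = (q : ℝ) ^ (d + 1) / (2 * (u q d : ℝ) ^ 2)) :
    (∀ i, i + 1 < d → b i = sylvesterWeight q i) ∧ b (d - 1) = q / (2 * u q d) ∧
      b d = q / (2 * u q d) := by
  have hq1 : 1 ≤ q := by omega
  have hq0 : (0 : ℝ) < q := by exact_mod_cast hq1
  have hP0 : (q : ℝ) ^ (0 + 1) / u q (0 + 1) ≤ ∏ i ∈ Finset.range 0, b i := by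
    simp [u]; field_simp; exact le_rfl
  have hsq {j : ℕ} (hjd : j < d)
      (hj : (q : ℝ) ^ (j + 1) / u q (j + 1) ≤ ∏ i ∈ Finset.range j, b i) :
      (q : ℝ) / u q (j + 1) ≤ ∑ i ∈ Finset.Ico j (d + 1), b i := by
    have h3 := hj.trans (hC j hjd)
    rw [pow_succ, mul_div_assoc] at h3
    exact le_of_mul_le_mul_left h3 (by positivity)
  have hmain : ∀ t, ∀ k, k + t + 1 = d →
      ∏ i ∈ Finset.range k, b i = (q : ℝ) ^ (k + 1) / u q (k + 1) ∧
      ∑ i ∈ Finset.Ico k (d + 1), b i = q / u q (k + 1) ∧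
      (0 < t → b k = sylvesterWeight q k) := by
    intro t
    induction t with
    | zero =>
      intro k hkd
      obtain ⟨j, hjd, hj, hk⟩ := exists_max_of_zero
        (p := fun j => (q : ℝ) ^ (j + 1) / u q (j + 1) ≤ ∏ i ∈ Finset.range j, b i) hP0 hd
      obtain ⟨h1, h2⟩ := tail_sum_le hq1 (by omega) hb hpos hjd hj
        (fun k h h' => not_le.1 (hk k h h')) heq.le
      have h3 := h1.antisymm (hsq hjd hj)
      obtain rfl : j = k := by
        rcases (h2 h3).2 with h | ⟨h, h'⟩
        · omega
        · have := mul_le_u q hq1 (by omega : 1 ≤ j + 1)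
          rw [h] at this
          have hj0 : j = 0 := by nlinarith
          subst hj0
          exact absurd ⟨by omega, by omega⟩ hdq
      refine ⟨le_antisymm ?_ hj, h3, fun h => by omega⟩
      refine (hC j hjd).trans (le_of_eq ?_)
      rw [h3, pow_succ, mul_div_assoc]
    | succ t ih =>
      intro k hkd
      obtain ⟨hP, hR, -⟩ := ih (k + 1) (by omega)
      obtain ⟨j, hjd, hj, hk⟩ := exists_max_of_zero
        (p := fun j => (q : ℝ) ^ (j + 1) / u q (j + 1) ≤ ∏ i ∈ Finset.range j, b i) hP0
        (by omega : 0 < k + 1)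
      have hYj : 0 < (q : ℝ) ^ (j + 1) / u q (j + 1) := by
        have := u_cast_pos hq1 (by omega : 1 ≤ j + 1)
        positivity
      have hIcoY (k : ℕ) (h : j ≤ k) : (q : ℝ) ^ (j + 1) / u q (j + 1) *
          ∏ i ∈ Finset.Ico j k, sylvesterWeight q i = (q : ℝ) ^ (k + 1) / u q (k + 1) := by
        rw [← prod_range_sylvesterWeight hq1, ← prod_range_sylvesterWeight hq1]
        exact Finset.prod_range_mul_prod_Ico _ h
      have hle : ∀ k', j ≤ k' → k' ≤ k + 1 → ∏ i ∈ Finset.Ico j k', b i ≤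
          ∏ i ∈ Finset.Ico j k', sylvesterWeight q i := by
        intro k' h h'
        rcases eq_or_lt_of_le h with rfl | hlt
        · simp
        refine le_of_mul_le_mul_left ?_ hYj
        rw [hIcoY k' h]
        have h5 : ∏ i ∈ Finset.range k', b i ≤ (q : ℝ) ^ (k' + 1) / u q (k' + 1) := by
          rcases eq_or_lt_of_le h' with rfl | hlt'
          · exact hP.le
          · exact (not_le.1 (hk k' hlt hlt')).le
        refine le_trans ?_ h5
        rw [← Finset.prod_range_mul_prod_Ico _ h]
        exact mul_le_mul_of_nonneg_right hj (Finset.prod_nonneg fun i _ => (hpos i).le)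
      -- With `c = 0` only the comparison of sums remains; the lc inequality at `j` reverses it, so
      -- `b` and the weights coincide on `[j, k]`.
      obtain ⟨h1, h2⟩ := mul_log_prod_div_le_sum_sub hb hpos (sylvesterWeight_pos hq1) (by omega)
        hle (c := 0) (fun i _ _ => (hpos i).le)
      rw [zero_mul, sum_sylvesterWeight hq1 (by omega : j ≤ k + 1)] at h1 h2
      have h3 := hsq (by omega) hj
      rw [← Finset.sum_Ico_consecutive _ (by omega : j ≤ k + 1) (by omega : k + 1 ≤ d + 1), hR] at h3
      have h4 := h2 (by linarith)
      obtain rfl : j = k := by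
        by_contra hne
        refine hk (j + 1) (by omega) (by omega) ?_
        rw [← hIcoY (j + 1) (by omega), Finset.prod_range_succ]
        simp only [Nat.Ico_succ_singleton, Finset.prod_singleton, h4 j le_rfl (by omega)]
        exact mul_le_mul_of_nonneg_right hj (hpos j).le
      have h5 := h4 j le_rfl (by omega)
      refine ⟨?_, ?_, fun _ => h5.symm⟩
      · have := hIcoY (j + 1) (by omega)
        rw [← hP, Finset.prod_range_succ] at this
        simp only [Nat.Ico_succ_singleton, Finset.prod_singleton, h5] at this
        exact (mul_right_cancel₀ (hpos j).ne' this).symm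
      · rw [← Finset.sum_Ico_consecutive _ (by omega : j ≤ j + 1) (by omega : j + 1 ≤ d + 1), hR]
        linarith
  obtain ⟨e, rfl⟩ := Nat.exists_eq_add_of_le' hd
  obtain ⟨hP, hR, -⟩ := hmain 0 e rfl
  have hU := u_cast_pos hq1 hd
  have hbe : b e = q / (2 * u q (e + 1)) := by
    rw [Finset.prod_range_succ, hP] at heq
    refine mul_left_cancel₀ (by positivity : (q : ℝ) ^ (e + 1) / u q (e + 1) ≠ 0) ?_
    rw [heq]; field_simp; ring
  refine ⟨fun i hi => (hmain (e - i) i (by omega)).2.2 (by omega), hbe, ?_⟩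
  rw [Finset.sum_Ico_succ_top (by omega), Finset.sum_Ico_succ_top le_rfl] at hR
  simp only [Finset.Ico_self, Finset.sum_empty, hbe] at hR
  have : (q : ℝ) / u q (e + 1) = q / (2 * u q (e + 1)) + q / (2 * u q (e + 1)) := by
    field_simp; ring
  linarith

/-! ### Minkowski's theorem for a rank-one perturbation of the identity -/

open MeasureTheory in
/-- Minkowski's theorem for the linear forms `a i - β i * ∑ k, a k`. -/
theorem exists_int_forall_abs_sub_lt {ι : Type*} [Fintype ι] {β δ : ι → ℝ}
    (hδ : ∀ i, 0 < δ i) (hβ : ∑ i, β i < 1) (h : 1 - ∑ i, β i < ∏ i, δ i) :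
    ∃ a : ι → ℤ, a ≠ 0 ∧ ∀ i, |(a i : ℝ) - (∑ k, (a k : ℝ)) * β i| < δ i := by
  classical
  -- The forms have matrix `1 - β 1ᵀ`, of determinant `1 - ∑ β i`; the preimage of the box thus has
  -- volume `2 ^ n * ∏ δ i / (1 - ∑ β i)`, with `n` the number of forms, which exceeds `2 ^ n` by
  -- `h`.
  let M : Matrix ι ι ℝ :=
    1 + Matrix.replicateCol Unit (-β) * Matrix.replicateRow Unit (1 : ι → ℝ)
  have hdet : M.det = 1 - ∑ i, β i := by
    rw [Matrix.det_one_add_replicateCol_mul_replicateRow]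
    simp [dotProduct, sub_eq_add_neg]
  have hM (x : ι → ℝ) (i : ι) : Matrix.toLin' M x i = x i - (∑ k, x k) * β i := by
    simp [M, Matrix.mulVec, dotProduct, Matrix.mul_apply, ← Finset.mul_sum]
    ring
  have hdet' : LinearMap.det (Matrix.toLin' M) = 1 - ∑ i, β i := by
    rw [LinearMap.det_toLin', hdet]
  have hpos : 0 < 1 - ∑ i, β i := by linarith
  let box : Set (ι → ℝ) := Set.pi Set.univ fun i => Set.Ioo (-δ i) (δ i)
  let s : Set (ι → ℝ) := Matrix.toLin' M ⁻¹' box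
  let b := Pi.basisFun ℝ ι
  have hfund := ZSpan.isAddFundamentalDomain' b (volume : Measure (ι → ℝ))
  have hbox : volume box = ENNReal.ofReal (2 ^ Fintype.card ι * ∏ i, δ i) := by
    rw [Real.volume_pi_Ioo, ← ENNReal.ofReal_prod_of_nonneg]
    · congr 1
      rw [← Finset.card_univ, ← Finset.prod_const, ← Finset.prod_mul_distrib]
      exact Finset.prod_congr rfl fun i _ => by ring
    · intro i _; linarith [hδ i]
  have hs : volume s = ENNReal.ofReal ((1 - ∑ i, β i)⁻¹ * (2 ^ Fintype.card ι * ∏ i, δ i)) := by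
    rw [Measure.addHaar_preimage_linearMap _ (by rw [hdet']; exact hpos.ne'), hdet', hbox,
      ← ENNReal.ofReal_mul (abs_nonneg _), abs_of_pos (by positivity)]
  have hvol : volume (ZSpan.fundamentalDomain b) * 2 ^ Module.finrank ℝ (ι → ℝ) < volume s := by
    rw [hs, ZSpan.fundamentalDomain_pi_basisFun, Real.volume_pi_Ico]
    simp only [sub_zero, ENNReal.ofReal_one, Finset.prod_const_one, one_mul,
      Module.finrank_fintype_fun_eq_card]
    rw [show (2 : ℝ≥0∞) ^ Fintype.card ι = ENNReal.ofReal (2 ^ Fintype.card ι) by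
      rw [ENNReal.ofReal_pow (by norm_num)]; simp]
    refine (ENNReal.ofReal_lt_ofReal_iff ?_).2 ?_
    · have : 0 < ∏ i, δ i := Finset.prod_pos fun i _ => hδ i
      positivity
    · rw [inv_mul_eq_div, lt_div_iff₀ hpos]
      gcongr
  have hconv : Convex ℝ s :=
    (convex_pi fun i _ => convex_Ioo _ _).linear_preimage (Matrix.toLin' M)
  have hsymm : ∀ x ∈ s, -x ∈ s := by
    intro x hx i hi
    have := hx i hi
    rw [map_neg]
    simp only [Pi.neg_apply, Set.mem_Ioo] at this ⊢
    constructor <;> linarith [this.1, this.2]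
  have : Countable (Submodule.span ℤ (Set.range b)).toAddSubgroup :=
    inferInstanceAs (Countable (Submodule.span ℤ (Set.range b)))
  obtain ⟨x, hx0, hxs⟩ := exists_ne_zero_mem_lattice_of_measure_mul_two_pow_lt_measure
    hfund hsymm hconv hvol
  have hmem := (b.mem_span_iff_repr_mem ℤ (x : ι → ℝ)).1 x.2
  choose a ha using hmem
  have hax (i : ι) : (a i : ℝ) = (x : ι → ℝ) i := by simpa [b] using ha i
  refine ⟨a, fun h0 => hx0 ?_, fun i => ?_⟩
  · ext i
    simpa [h0] using (hax i).symm
  · have := hxs i (Set.mem_univ i)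
    rw [hM] at this
    simp only [hax]
    exact abs_lt.2 this

/-! ### Volumes of corner simplices -/

open MeasureTheory in
theorem volume_nonneg_sum_le (n : ℕ) {r : ℝ} (hr : 0 ≤ r) :
    volume {x : Fin n → ℝ | (∀ i, 0 ≤ x i) ∧ ∑ i, x i ≤ r} = ENNReal.ofReal (r ^ n / n !) := by
  induction n generalizing r with
  | zero =>
    have : {x : Fin 0 → ℝ | (∀ i, 0 ≤ x i) ∧ ∑ i, x i ≤ r} = Set.univ := by
      ext; simp [hr]
    rw [this]
    simp [volume_pi]
  | succ n ih =>
    -- Slice by the first coordinate `t`: the slices are the same simplices one dimension lower,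
    -- with `r - t` in place of `r`.
    let T : Set (ℝ × (Fin n → ℝ)) := {p | 0 ≤ p.1 ∧ (∀ i, 0 ≤ p.2 i) ∧ p.1 + ∑ i, p.2 i ≤ r}
    have hT : MeasurableSet T := by
      have h1 : IsClosed {p : ℝ × (Fin n → ℝ) | 0 ≤ p.1} :=
        isClosed_le continuous_const continuous_fst
      have h2 : IsClosed {p : ℝ × (Fin n → ℝ) | ∀ i, 0 ≤ p.2 i} := by
        rw [Set.ofPred_forall]
        exact isClosed_iInter fun i => isClosed_le (by fun_prop) (by fun_prop)
      have h3 : IsClosed {p : ℝ × (Fin n → ℝ) | p.1 + ∑ i, p.2 i ≤ r} :=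
        isClosed_le (by fun_prop) (by fun_prop)
      exact (h1.inter (h2.inter h3)).measurableSet
    have hpre : {x : Fin (n + 1) → ℝ | (∀ i, 0 ≤ x i) ∧ ∑ i, x i ≤ r} =
        MeasurableEquiv.piFinSuccAbove (fun _ => ℝ) 0 ⁻¹' T := by
      ext x
      simp [T, Fin.forall_fin_succ, Fin.sum_univ_succ, and_assoc,
        MeasurableEquiv.piFinSuccAbove, Fin.insertNthEquiv, Fin.tail]
    have hslice (t : ℝ) : volume (Prod.mk t ⁻¹' T) =
        (Set.Icc 0 r).indicator (fun t => ENNReal.ofReal ((r - t) ^ n / n !)) t := by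
      by_cases ht : t ∈ Set.Icc 0 r
      · rw [Set.indicator_of_mem ht, ← ih (sub_nonneg.2 ht.2)]
        congr 1
        ext x
        simp only [T, Set.mem_preimage, Set.mem_ofPred_eq, ht.1, true_and]
        refine and_congr_right fun _ => ?_
        constructor <;> intro h <;> linarith
      · rw [Set.indicator_of_notMem ht]
        convert measure_empty (μ := (volume : Measure (Fin n → ℝ)))
        ext x
        simp only [T, Set.mem_preimage, Set.mem_ofPred_eq, Set.mem_empty_iff_false, iff_false]
        rintro ⟨h1, h2, h3⟩
        exact ht ⟨h1, by linarith [Finset.sum_nonneg fun i (_ : i ∈ Finset.univ) => h2 i]⟩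
    rw [hpre, (volume_preserving_piFinSuccAbove (fun _ => ℝ) 0).measure_preimage
      hT.nullMeasurableSet]
    rw [Measure.volume_eq_prod, Measure.prod_apply hT]
    simp_rw [hslice]
    rw [lintegral_indicator measurableSet_Icc]
    rw [← ofReal_integral_eq_lintegral_ofReal, integral_Icc_eq_integral_Ioc,
      ← intervalIntegral.integral_of_le hr]
    · congr 1
      rw [intervalIntegral.integral_div,
        intervalIntegral.integral_comp_sub_left (fun x => x ^ n) r, integral_pow]
      simp [Nat.factorial_succ]
      field_simp
    · exact (Continuous.continuousOn (by fun_prop)).integrableOn_Icc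
    · refine (ae_restrict_iff' measurableSet_Icc).2 (Filter.Eventually.of_forall fun t ht => ?_)
      have : 0 ≤ r - t := sub_nonneg.2 ht.2
      simp only [Pi.zero_apply]
      positivity

/-- The simplex cut out of the positive orthant by `∑ i, β i * x i ≤ 1`. -/
def cornerSimplex {d : ℕ} (β : Fin d → ℝ) : Set (Fin d → ℝ) :=
  {x | (∀ i, 0 ≤ x i) ∧ ∑ i, β i * x i ≤ 1}

open MeasureTheory in
theorem normalizedVol_cornerSimplex {d : ℕ} {β : Fin d → ℝ} (hβ : ∀ i, 0 < β i) :
    normalizedVol (cornerSimplex β) = ENNReal.ofReal (∏ i, β i)⁻¹ := by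
  have hpre : cornerSimplex β = Matrix.toLin' (Matrix.diagonal β) ⁻¹'
      {x : Fin d → ℝ | (∀ i, 0 ≤ x i) ∧ ∑ i, x i ≤ 1} := by
    ext x
    simp [cornerSimplex, Matrix.mulVec_diagonal, hβ]
  have hpos : 0 < ∏ i, β i := Finset.prod_pos fun i _ => hβ i
  have hdet : LinearMap.det (Matrix.toLin' (Matrix.diagonal β)) = ∏ i, β i := by
    rw [LinearMap.det_toLin', Matrix.det_diagonal]
  rw [normalizedVol, hpre, Measure.addHaar_preimage_linearMap _ (by rw [hdet]; exact hpos.ne'),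
    volume_nonneg_sum_le d zero_le_one, hdet, abs_of_pos (inv_pos.2 hpos), mul_left_comm,
    ← ENNReal.ofReal_natCast, ← ENNReal.ofReal_mul (by positivity)]
  simp [Nat.factorial_ne_zero]

/-! ### Integral affine equivalences -/

theorem mem_lattice_iff {d : ℕ} {x : Fin d → ℝ} : x ∈ lattice d ↔ ∀ i, ∃ z : ℤ, (z : ℝ) = x i := by
  constructor
  · rintro ⟨z, rfl⟩ i
    exact ⟨z i, rfl⟩
  · intro h
    choose z hz using h
    exact ⟨z, funext hz⟩

theorem sub_mem_lattice {d : ℕ} {x y : Fin d → ℝ} (hx : x ∈ lattice d) (hy : y ∈ lattice d) :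
    x - y ∈ lattice d := by
  obtain ⟨a, rfl⟩ := hx
  obtain ⟨b, rfl⟩ := hy
  exact ⟨a - b, by ext; simp⟩

theorem exists_affineEquiv_of_isUnit_det {d : ℕ} {A : Matrix (Fin d) (Fin d) ℤ}
    (hA : IsUnit A.det) (w : Fin d → ℤ) :
    ∃ f : (Fin d → ℝ) ≃ᵃ[ℝ] (Fin d → ℝ), f '' lattice d = lattice d ∧
      ∀ x, f x = (A.map (Int.cast : ℤ → ℝ)).mulVec x + fun i => (w i : ℝ) := by
  have h1 : A.map (Int.cast : ℤ → ℝ) * A⁻¹.map (Int.cast : ℤ → ℝ) = 1 := by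
    change A.map (Int.castRingHom ℝ) * A⁻¹.map (Int.castRingHom ℝ) = 1
    rw [← Matrix.map_mul, Matrix.mul_nonsing_inv A hA, Matrix.map_one _ (map_zero _) (map_one _)]
  have h2 : A⁻¹.map (Int.cast : ℤ → ℝ) * A.map (Int.cast : ℤ → ℝ) = 1 := by
    change A⁻¹.map (Int.castRingHom ℝ) * A.map (Int.castRingHom ℝ) = 1
    rw [← Matrix.map_mul, Matrix.nonsing_inv_mul A hA, Matrix.map_one _ (map_zero _) (map_one _)]
  have hint (B : Matrix (Fin d) (Fin d) ℤ) (z : Fin d → ℤ) :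
      (B.map (Int.cast : ℤ → ℝ)).mulVec (fun i => (z i : ℝ)) = fun i => ((B.mulVec z) i : ℝ) := by
    ext i
    simp [Matrix.mulVec, dotProduct]
  have hf : ∀ x, ((Matrix.toLin'OfInv h2 h1).toAffineEquiv.trans
      (AffineEquiv.constVAdd ℝ (Fin d → ℝ) fun i => (w i : ℝ))) x =
      (A.map (Int.cast : ℤ → ℝ)).mulVec x + fun i => (w i : ℝ) := by
    intro x
    rw [AffineEquiv.trans_apply, AffineEquiv.constVAdd_apply, vadd_eq_add, add_comm,
      LinearEquiv.coe_toAffineEquiv]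
    rfl
  refine ⟨_, ?_, hf⟩
  ext y
  constructor
  · rintro ⟨_, ⟨z, rfl⟩, rfl⟩
    rw [hf, hint]
    exact ⟨A.mulVec z + w, by ext; simp⟩
  · rintro ⟨z, rfl⟩
    refine ⟨_, ⟨A⁻¹.mulVec (z - w), rfl⟩, ?_⟩
    rw [hf, hint, Matrix.mulVec_mulVec, Matrix.mul_nonsing_inv A hA]
    ext; simp

theorem UnimodularEquiv.trans {d : ℕ} {P Q R : Set (Fin d → ℝ)} (h : UnimodularEquiv P Q)
    (h' : UnimodularEquiv Q R) : UnimodularEquiv P R := by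
  obtain ⟨f, hf, hP⟩ := h
  obtain ⟨g, hg, hQ⟩ := h'
  refine ⟨f.trans g, ?_, ?_⟩
  · rw [AffineEquiv.coe_trans, Set.image_comp, hf, hg]
  · rw [AffineEquiv.coe_trans, Set.image_comp, hP, hQ]

theorem exists_int_toMatrix {d : ℕ} (f : (Fin d → ℝ) ≃ᵃ[ℝ] (Fin d → ℝ))
    (hf : f '' lattice d = lattice d) :
    ∃ A : Matrix (Fin d) (Fin d) ℤ,
      LinearMap.toMatrix' (f.linear : (Fin d → ℝ) →ₗ[ℝ] (Fin d → ℝ)) = A.map (Int.castRingHom ℝ) := by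
  have hmem (x : Fin d → ℝ) (hx : x ∈ lattice d) : f x ∈ lattice d :=
    hf ▸ Set.mem_image_of_mem f hx
  have h (i j : Fin d) : ∃ z : ℤ, (z : ℝ) =
      LinearMap.toMatrix' (f.linear : (Fin d → ℝ) →ₗ[ℝ] (Fin d → ℝ)) i j := by
    have h1 : f.linear (Pi.single j 1) = f (Pi.single j 1) - f 0 := by
      have := f.toAffineMap.linearMap_vsub (Pi.single j (1 : ℝ)) 0
      simpa using this
    have h2 : f.linear (Pi.single j 1) ∈ lattice d := by
      rw [h1]
      refine sub_mem_lattice (hmem _ ⟨Pi.single j 1, ?_⟩) (hmem _ ⟨0, ?_⟩)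
      · ext k
        by_cases hk : k = j
        · subst hk; simp
        · simp [hk]
      · ext; simp
    simpa [LinearMap.toMatrix'_apply] using mem_lattice_iff.1 h2 i
  choose A hA using h
  exact ⟨Matrix.of A, by ext i j; simp [hA]⟩

/-- The linear parts of `f` and of its inverse are both integer matrices, so the determinant is a
unit of `ℤ`. -/
theorem abs_det_linear_eq_one {d : ℕ} (f : (Fin d → ℝ) ≃ᵃ[ℝ] (Fin d → ℝ))
    (hf : f '' lattice d = lattice d) :
    |LinearMap.det (f.linear : (Fin d → ℝ) →ₗ[ℝ] (Fin d → ℝ))| = 1 := by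
  have hf' : f.symm '' lattice d = lattice d := by
    conv_lhs => rw [← hf]
    rw [← Set.image_comp]
    convert Set.image_id _
    ext x
    simp
  obtain ⟨A, hA⟩ := exists_int_toMatrix f hf
  obtain ⟨B, hB⟩ := exists_int_toMatrix f.symm hf'
  have hAB : A * B = 1 := by
    have h1 : (A * B).map (Int.castRingHom ℝ) = (1 : Matrix (Fin d) (Fin d) ℤ).map (Int.castRingHom ℝ) := by
      rw [Matrix.map_mul, ← hA, ← hB, ← LinearMap.toMatrix'_comp]
      have : (f.linear : (Fin d → ℝ) →ₗ[ℝ] (Fin d → ℝ)) ∘ₗ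
          (f.symm.linear : (Fin d → ℝ) →ₗ[ℝ] (Fin d → ℝ)) = LinearMap.id := by
        ext x : 1
        simp
      rw [this, LinearMap.toMatrix'_id]
      simp
    exact Matrix.map_injective (RingHom.injective_int (Int.castRingHom ℝ)) h1
  have hdet : IsUnit A.det := IsUnit.of_mul_eq_one B.det (by rw [← Matrix.det_mul, hAB, Matrix.det_one])
  have h2 : LinearMap.det (f.linear : (Fin d → ℝ) →ₗ[ℝ] (Fin d → ℝ)) = (A.det : ℝ) := by
    rw [← LinearMap.det_toMatrix', hA, ← RingHom.mapMatrix_apply, ← RingHom.map_det]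
    simp
  rw [h2, ← Int.cast_abs, Int.isUnit_iff_abs_eq.1 hdet, Int.cast_one]

open MeasureTheory in
theorem UnimodularEquiv.normalizedVol_eq {d : ℕ} {P Q : Set (Fin d → ℝ)}
    (h : UnimodularEquiv P Q) : normalizedVol P = normalizedVol Q := by
  obtain ⟨f, hf, rfl⟩ := h
  have h1 : f '' P = (fun x => f 0 + x) '' (f.linear '' P) := by
    rw [← Set.image_comp]
    refine Set.image_congr fun x _ => ?_
    have := f.toAffineMap.linearMap_vsub x 0
    simp at this
    simp [this]
  have h2 := Measure.addHaar_image_linearMap (volume : Measure (Fin d → ℝ))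
    (f.linear : (Fin d → ℝ) →ₗ[ℝ] (Fin d → ℝ)) P
  rw [abs_det_linear_eq_one f hf, ENNReal.ofReal_one, one_mul] at h2
  rw [normalizedVol, normalizedVol, h1, Set.image_add_left, measure_preimage_add]
  exact congrArg _ h2.symm

/-! ### The extremal simplex -/

theorem cornerSimplex_eq_convexHull {d : ℕ} {β : Fin d → ℝ} (hβ : ∀ i, 0 < β i) :
    cornerSimplex β =
      convexHull ℝ (insert 0 (Set.range fun i => (β i)⁻¹ • Pi.single i (1 : ℝ))) := by
  apply Set.Subset.antisymm
  · rintro x ⟨hx0, hx1⟩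
    have key := (convex_convexHull ℝ
      (insert 0 (Set.range fun i => (β i)⁻¹ • (Pi.single i (1 : ℝ) : Fin d → ℝ)))).sum_mem
      (t := (Finset.univ : Finset (Option (Fin d))))
      (w := fun o => o.elim (1 - ∑ i, β i * x i) fun i => β i * x i)
      (z := fun o => o.elim 0 fun i => (β i)⁻¹ • Pi.single i (1 : ℝ))
      (by
        rintro (_ | i) -
        · simpa using hx1
        · exact mul_nonneg (hβ i).le (hx0 i))
      (by simp [Fintype.sum_option])
      (by
        rintro (_ | i) - <;> apply subset_convexHull
        · exact Set.mem_insert _ _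
        · exact Set.mem_insert_of_mem _ ⟨i, rfl⟩)
    convert key using 1
    ext k
    simp [Fintype.sum_option, Finset.sum_apply, Pi.single_apply]
    have := (hβ k).ne'
    field_simp
  · refine convexHull_min ?_ ?_
    · rintro _ (rfl | ⟨i, rfl⟩)
      · simp [cornerSimplex]
      · refine ⟨fun k => ?_, ?_⟩
        · have := hβ i
          by_cases h : k = i
          · subst h; simp; positivity
          · simp [h]
        · simp [Pi.single_apply, (hβ i).ne']
    · intro x hx y hy a b ha hb hab
      refine ⟨fun i => ?_, ?_⟩
      · have := hx.1 i
        have := hy.1 i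
        simp only [Pi.add_apply, Pi.smul_apply, smul_eq_mul]
        positivity
      · calc ∑ i, β i * (a • x + b • y) i
            = a * ∑ i, β i * x i + b * ∑ i, β i * y i := by
              rw [Finset.mul_sum, Finset.mul_sum, ← Finset.sum_add_distrib]
              refine Finset.sum_congr rfl fun i _ => ?_
              simp; ring
          _ ≤ a * 1 + b * 1 := by gcongr; exacts [hx.2, hy.2]
          _ = 1 := by linarith

theorem u_dvd_u (q : ℕ) {j k : ℕ} (hj : 1 ≤ j) (hjk : j ≤ k) : u q j ∣ u q k := by
  induction k, hjk using Nat.le_induction with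
  | base => exact dvd_rfl
  | succ k hjk ih => exact ih.trans (u_succ q (hj.trans hjk) ▸ Dvd.intro _ rfl)

theorem one_add_u_dvd_u (q : ℕ) {j k : ℕ} (hj : 1 ≤ j) (hjk : j < k) : 1 + u q j ∣ u q k :=
  (Dvd.intro_left (u q j) (by rw [u_succ q hj, add_comm])).trans (u_dvd_u q (by omega : 1 ≤ j + 1) hjk)

/-- The barycentric coordinates of the origin in the extremal case, except for the last one. -/
noncomputable def extremalWeight (d q : ℕ) (i : Fin d) : ℝ :=
  if (i : ℕ) + 1 < d then sylvesterWeight q i else q / (2 * u q d)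

theorem extremalWeight_pos {d q : ℕ} (hd : 1 ≤ d) (hq : 1 ≤ q) (i : Fin d) :
    0 < extremalWeight d q i := by
  have := u_cast_pos hq hd
  have h : (0 : ℝ) < q := by exact_mod_cast hq
  unfold extremalWeight
  split_ifs
  · exact sylvesterWeight_pos hq i
  · positivity

theorem prod_extremalWeight {d q : ℕ} (hd : 1 ≤ d) (hq : 1 ≤ q) :
    ∏ i, extremalWeight d q i = (q : ℝ) ^ (d + 1) / (2 * (u q d : ℝ) ^ 2) := by
  obtain ⟨e, rfl⟩ := Nat.exists_eq_add_of_le' hd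
  have := u_cast_pos hq hd
  rw [Fin.prod_univ_castSucc]
  simp only [extremalWeight, Fin.val_castSucc, Fin.val_last, lt_irrefl, if_false]
  rw [Finset.prod_congr rfl (fun i _ => if_pos (by have := i.2; omega)),
    Fin.prod_univ_eq_prod_range (fun i => sylvesterWeight q i), prod_range_sylvesterWeight hq]
  field_simp; ring

/-- With `p = u q d / q`, the map adds `∑ k, c k * x k - p` to the last coordinate. The origin goes
to `-p e_d` and `2p e_d` to `p e_d`; taking `c k = u q d / (1 + u q (k + 1))`, an integer because `1
+ u_j` divides every later term, fixes the other vertices. -/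
theorem unimodularEquiv_cornerSimplex_extremalSimplex {d q : ℕ} (hd : 1 ≤ d) (hq : 1 ≤ q) :
    UnimodularEquiv (cornerSimplex (extremalWeight d q)) (extremalSimplex d q) := by
  have hq0 : (0 : ℝ) < q := by exact_mod_cast hq
  have hu := u_cast_pos hq hd
  obtain ⟨p, hp⟩ : q ∣ u q d := u_dvd_u q le_rfl hd
  have hp' : (u q d : ℝ) / q = p := by rw [hp]; push_cast; field_simp
  have hc : ∀ k : Fin d, ∃ c : ℤ, ((k : ℕ) + 1 < d → (u q d : ℝ) = (1 + u q (k + 1)) * c) ∧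
      (¬ (k : ℕ) + 1 < d → c = 0) := by
    intro k
    by_cases hk : (k : ℕ) + 1 < d
    · obtain ⟨c, hc⟩ := one_add_u_dvd_u q (by omega : 1 ≤ (k : ℕ) + 1) hk
      exact ⟨c, fun _ => by rw [hc]; push_cast; rfl, fun h => absurd hk h⟩
    · exact ⟨0, fun h => absurd h hk, fun _ => rfl⟩
  choose c hc1 hc2 using hc
  let l : Fin d := ⟨d - 1, by omega⟩
  have hl (k : Fin d) : ¬ (k : ℕ) + 1 < d ↔ k = l := by
    rw [Fin.ext_iff]; have := k.2; simp only [l]; omega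
  have hl' (k : Fin d) : (k : ℕ) + 1 = d ↔ k = l := by
    rw [Fin.ext_iff]; have := k.2; simp only [l]; omega
  let A : Matrix (Fin d) (Fin d) ℤ := 1 + Matrix.replicateCol Unit (Pi.single l (1 : ℤ)) *
    Matrix.replicateRow Unit c
  have hA : A.det = 1 := by
    rw [Matrix.det_one_add_replicateCol_mul_replicateRow]
    simp [hc2 l ((hl l).2 rfl)]
  obtain ⟨f, hf, hfx⟩ := exists_affineEquiv_of_isUnit_det (A := A) (by simp [hA])
    (Pi.single l (-(p : ℤ)))
  have hfx' (x : Fin d → ℝ) :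
      f x = x + (∑ k, (c k : ℝ) * x k - p) • (Pi.single l (1 : ℝ) : Fin d → ℝ) := by
    rw [hfx]
    ext i
    by_cases h : i = l
    · subst h
      simp [A, Matrix.mulVec, dotProduct, Matrix.mul_apply, Matrix.one_apply, add_mul,
        Finset.sum_add_distrib]
      ring
    · simp [A, Matrix.mulVec, dotProduct, Matrix.mul_apply, Matrix.one_apply, h]
  have hf0 : f 0 = (-((u q d : ℝ) / q)) • Pi.single l (1 : ℝ) := by
    rw [hfx', hp']; simp
  have hfl : f ((extremalWeight d q l)⁻¹ • Pi.single l (1 : ℝ)) =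
      ((u q d : ℝ) / q) • Pi.single l (1 : ℝ) := by
    have h1 : (extremalWeight d q l)⁻¹ = 2 * p := by
      rw [extremalWeight, if_neg ((hl l).2 rfl), ← hp']; field_simp
    rw [hfx', hp', h1]
    simp only [Pi.smul_apply, Pi.single_apply, smul_eq_mul, mul_ite, mul_one, mul_zero,
      Finset.sum_ite_eq', Finset.mem_univ, if_true, hc2 l ((hl l).2 rfl), Int.cast_zero, zero_mul]
    rw [← add_smul]
    congr 1; ring
  have hfi (i : Fin d) (hi : (i : ℕ) + 1 < d) :
      f ((extremalWeight d q i)⁻¹ • Pi.single i (1 : ℝ)) =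
      ((1 + (u q ((i : ℕ) + 1) : ℝ)) / q) • Pi.single i (1 : ℝ) := by
    have h1 : (extremalWeight d q i)⁻¹ = (1 + (u q ((i : ℕ) + 1) : ℝ)) / q := by
      rw [extremalWeight, if_pos hi, sylvesterWeight, inv_div]
    rw [hfx', h1, ← hp', hc1 i hi]
    simp only [Pi.smul_apply, Pi.single_apply, smul_eq_mul, mul_ite, mul_one, mul_zero,
      Finset.sum_ite_eq', Finset.mem_univ, if_true]
    convert add_zero _
    rw [smul_eq_zero]
    left; ring
  refine ⟨f, hf, ?_⟩
  rw [cornerSimplex_eq_convexHull (extremalWeight_pos hd hq), extremalSimplex]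
  have himg := f.toAffineMap.image_convexHull
    (insert 0 (Set.range fun i => (extremalWeight d q i)⁻¹ • (Pi.single i (1 : ℝ) : Fin d → ℝ)))
  rw [AffineEquiv.coe_toAffineMap] at himg
  rw [himg]
  congr 1
  rw [Set.image_insert_eq, ← Set.range_comp]
  ext y
  simp only [Set.mem_insert_iff, Set.mem_range, Function.comp_apply, Set.mem_union,
    Set.mem_ofPred_eq]
  constructor
  · rintro (rfl | ⟨i, rfl⟩)
    · exact Or.inr ⟨l, (hl' l).2 rfl, Or.inl hf0⟩
    · by_cases hi : (i : ℕ) + 1 < d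
      · exact Or.inl ⟨i, hi, hfi i hi⟩
      · obtain rfl := (hl i).1 hi
        exact Or.inr ⟨l, (hl' l).2 rfl, Or.inr hfl⟩
  · rintro (⟨i, hi, rfl⟩ | ⟨i, hi, rfl | rfl⟩)
    · exact Or.inr ⟨i, hfi i hi⟩
    · obtain rfl := (hl' i).1 hi
      exact Or.inl hf0.symm
    · obtain rfl := (hl' i).1 hi
      exact Or.inr ⟨l, hfl⟩

/-! ### Fano simplices -/

/-- The vertices of a simplex with the origin in its interior, ordered by decreasing barycentric
coordinate of the origin. -/
theorem exists_affineBasis {d : ℕ} {S : Set (Fin d → ℝ)} (hS : IsSimplex S)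
    (h0 : 0 ∈ interior S) :
    ∃ v : AffineBasis (Fin (d + 1)) ℝ (Fin d → ℝ), S = convexHull ℝ (Set.range v) ∧
      Set.range v = vert S ∧ Antitone (fun i => v.coord i 0) ∧ ∀ i, 0 < v.coord i 0 := by
  obtain ⟨⟨hbdd, n, a, b, hab⟩, hspan, hcard⟩ := hS
  have hab' : S = ⋂ i, {x | a i ⬝ᵥ x ≤ b i} := by rw [hab]; ext; simp
  have hclosed : IsClosed S := by
    rw [hab']
    exact isClosed_iInter fun i => isClosed_le (by unfold dotProduct; fun_prop) continuous_const
  have hconv : Convex ℝ S := by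
    rw [hab']
    refine convex_iInter fun i => ?_
    intro x hx y hy s t hs ht hst
    simp only [Set.mem_ofPred_eq] at hx hy ⊢
    rw [dotProduct_add, dotProduct_smul, dotProduct_smul, smul_eq_mul, smul_eq_mul]
    calc s * (a i ⬝ᵥ x) + t * (a i ⬝ᵥ y) ≤ s * b i + t * b i := by gcongr
      _ = b i := by rw [← add_mul, hst, one_mul]
  have hcomp : IsCompact S := Metric.isCompact_of_isClosed_isBounded hclosed hbdd
  -- `ncard` would be `0` for an infinite set, so the value `d + 1` gives finiteness; Krein–Milman
  -- then makes `S` the hull of its vertices.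
  have hfin : (vert S).Finite := Set.finite_of_ncard_ne_zero (by omega)
  have hhull : convexHull ℝ (vert S) = S := by
    have : closure (convexHull ℝ (vert S)) = S := closure_convexHull_extremePoints hcomp hconv
    rwa [(Set.Finite.isCompact_convexHull ℝ hfin).isClosed.closure_eq] at this
  have := hfin.to_subtype
  let e : vert S ≃ Fin (d + 1) := Finite.equivFinOfCardEq (by rw [Nat.card_coe_set_eq, hcard])
  let p : Fin (d + 1) → Fin d → ℝ := fun i => (e.symm i : Fin d → ℝ)
  have hrange : Set.range p = vert S := by
    have : p = Subtype.val ∘ e.symm := rfl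
    rw [this, Set.range_comp, e.symm.surjective.range_eq, Set.image_univ, Subtype.range_coe]
  have htop : affineSpan ℝ (Set.range p) = ⊤ := by
    rw [hrange, ← affineSpan_convexHull, hhull, hspan]
  have hind : AffineIndependent ℝ p := by
    rw [affineIndependent_iff_finrank_vectorSpan_eq ℝ p (Fintype.card_fin _)]
    rw [(AffineSubspace.affineSpan_eq_top_iff_vectorSpan_eq_top_of_nonempty ℝ _ _
      (Set.range_nonempty p)).1 htop]
    simp
  let v₀ : AffineBasis (Fin (d + 1)) ℝ (Fin d → ℝ) := ⟨p, hind, htop⟩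
  let σ := Tuple.sort fun i => -v₀.coord i 0
  have hσ := Tuple.monotone_sort fun i => -v₀.coord i 0
  have hv : Set.range (v₀.reindex σ.symm) = vert S := by
    rw [← hrange]
    ext x
    simp only [Set.mem_range, AffineBasis.reindex_apply, Equiv.symm_symm]
    exact (σ.surjective.exists (p := fun y => p y = x)).symm
  have hS' : S = convexHull ℝ (Set.range (v₀.reindex σ.symm)) := by rw [hv, hhull]
  refine ⟨v₀.reindex σ.symm, hS', hv, fun i j hij => ?_, ?_⟩
  · have := hσ hij
    simp only [Function.comp_apply, neg_le_neg_iff] at this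
    simpa [AffineBasis.coord_reindex] using this
  · rw [hS', AffineBasis.interior_convexHull] at h0
    exact h0

/-- The weights need not sum to `1`: the missing weight `1 - ∑ a i` is carried by the origin. -/
theorem coord_sum_smul {ι V : Type*} [Fintype ι] [AddCommGroup V] [Module ℝ V]
    (v : AffineBasis ι ℝ V) (a : ι → ℝ) (k : ι) :
    v.coord k (∑ i, a i • v i) = v.coord k 0 + (a k - (∑ i, a i) * v.coord k 0) := by
  classical
  have hlin (x : V) : v.coord k x = (v.coord k).linear x + v.coord k 0 :=
    congrFun (AffineMap.decomp (v.coord k)) x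
  have hi (i : ι) : (v.coord k).linear (v i) = (if k = i then 1 else 0) - v.coord k 0 := by
    rw [← AffineBasis.coord_apply v k i, hlin (v i), add_sub_cancel_right]
  rw [hlin]
  simp only [map_sum, map_smul, hi, smul_eq_mul, mul_sub, Finset.sum_sub_distrib, mul_ite, mul_one,
    mul_zero, Finset.sum_ite_eq, Finset.mem_univ, if_true, Finset.sum_mul]
  ring

/-- The barycentric coordinates of the origin, extended to a sequence indexed by `ℕ`. -/
noncomputable def originCoord {d : ℕ} (v : AffineBasis (Fin (d + 1)) ℝ (Fin d → ℝ)) (n : ℕ) : ℝ :=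
  v.coord ⟨min n d, by omega⟩ 0

section

variable {d : ℕ} {v : AffineBasis (Fin (d + 1)) ℝ (Fin d → ℝ)}

theorem originCoord_val (v : AffineBasis (Fin (d + 1)) ℝ (Fin d → ℝ)) (i : Fin (d + 1)) :
    originCoord v i = v.coord i 0 := by
  have : (⟨min (i : ℕ) d, by omega⟩ : Fin (d + 1)) = i :=
    Fin.ext (min_eq_left (Nat.lt_succ_iff.1 i.2))
  rw [originCoord, this]

theorem sum_originCoord (v : AffineBasis (Fin (d + 1)) ℝ (Fin d → ℝ)) :
    ∑ i ∈ Finset.range (d + 1), originCoord v i = 1 := by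
  rw [← Fin.sum_univ_eq_sum_range, ← v.sum_coord_apply_eq_one 0]
  exact Finset.sum_congr rfl fun i _ => originCoord_val v i

/-- If the inequality failed, Minkowski would give integers `a i`, `i < j`, not all zero, such that
the lattice point `∑ a i • v i` lies in the interior of `S / q`. It must then be the origin, which
forces `a = 0`. -/
theorem prod_le_of_lc {q : ℕ} (hq : 1 ≤ q) (hpos : ∀ i, 0 < v.coord i 0)
    (hint : ∀ i, v i ∈ lattice d)
    (hlc : interior ((1 / (q : ℝ)) • convexHull ℝ (Set.range v)) ∩ lattice d = {0}) {j : ℕ}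
    (hj : j < d) :
    ∏ i ∈ Finset.range j, originCoord v i ≤
      (q : ℝ) ^ j * ∑ i ∈ Finset.Ico j (d + 1), originCoord v i := by
  have hq0 : (0 : ℝ) < q := by exact_mod_cast hq
  have hb (n : ℕ) : 0 < originCoord v n := hpos _
  have hsum := sum_originCoord v
  rw [← Finset.sum_range_add_sum_Ico _ (by omega : j ≤ d + 1)] at hsum
  by_contra! hlt
  have hR : 0 < ∑ i ∈ Finset.Ico j (d + 1), originCoord v i :=
    Finset.sum_pos (fun i _ => hb i) ⟨j, by simp; omega⟩
  obtain ⟨a, ha0, ha⟩ := exists_int_forall_abs_sub_lt (β := fun i : Fin j => originCoord v i)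
    (δ := fun i : Fin j => originCoord v i / q) (fun i => div_pos (hb i) hq0)
    (by rw [Fin.sum_univ_eq_sum_range (fun i => originCoord v i)]; linarith)
    (by
      rw [Fin.sum_univ_eq_sum_range (fun i => originCoord v i),
        Fin.prod_univ_eq_prod_range (fun i => originCoord v i / q), Finset.prod_div_distrib,
        Finset.prod_const, Finset.card_range, lt_div_iff₀ (by positivity)]
      rw [show 1 - ∑ i ∈ Finset.range j, originCoord v i =
        ∑ i ∈ Finset.Ico j (d + 1), originCoord v i by linarith]
      linarith)
  -- Minkowski controls only the coordinates below `j`. The others receive weight `0` and contribute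
  -- `-N * b k`, where `N = ∑ a k`, so the sign of `a` is chosen to make `N ≤ 0`.
  have hwlog : ∃ a : Fin j → ℤ, a ≠ 0 ∧ (∑ k, (a k : ℝ)) ≤ 0 ∧
      ∀ i, |(a i : ℝ) - (∑ k, (a k : ℝ)) * originCoord v i| < originCoord v i / q := by
    rcases le_total (∑ k, (a k : ℝ)) 0 with h | h
    · exact ⟨a, ha0, h, ha⟩
    · refine ⟨-a, neg_ne_zero.2 ha0, by simpa using h, fun i => ?_⟩
      have := ha i
      rw [← abs_neg] at this
      convert this using 2
      simp only [Pi.neg_apply, Int.cast_neg, Finset.sum_neg_distrib]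
      ring
  obtain ⟨a, ha0, hN, ha⟩ := hwlog
  let c : Fin (d + 1) → ℤ := fun i => if h : (i : ℕ) < j then a ⟨i, h⟩ else 0
  have hcsum : ∑ i, (c i : ℝ) = ∑ k, (a k : ℝ) := by
    let c' : ℕ → ℝ := fun i => if h : i < j then (a ⟨i, h⟩ : ℝ) else 0
    have h1 : ∑ i, (c i : ℝ) = ∑ i ∈ Finset.range (d + 1), c' i := by
      rw [← Fin.sum_univ_eq_sum_range]
      refine Finset.sum_congr rfl fun i _ => ?_
      simp only [c, c']
      split_ifs <;> simp
    have h2 : ∑ k, (a k : ℝ) = ∑ i ∈ Finset.range j, c' i := by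
      rw [← Fin.sum_univ_eq_sum_range]
      refine Finset.sum_congr rfl fun i _ => ?_
      simp [c']
    rw [h1, h2, ← Finset.sum_range_add_sum_Ico _ (by omega : j ≤ d + 1), add_eq_left]
    refine Finset.sum_eq_zero fun i hi => ?_
    rw [Finset.mem_Ico] at hi
    simp only [c']
    rw [dif_neg (by omega)]
  set N := ∑ k, (a k : ℝ) with hNdef
  let z : Fin d → ℝ := ∑ i, (c i : ℝ) • v i
  have hzlat : z ∈ lattice d := by
    choose w hw using hint
    refine ⟨∑ i, c i • w i, ?_⟩
    ext k
    simp only [z, ← hw]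
    simp
  have hzint : z ∈ interior ((1 / (q : ℝ)) • convexHull ℝ (Set.range v)) := by
    rw [interior_smul₀ (by positivity), AffineBasis.interior_convexHull]
    refine ⟨(q : ℝ) • z, fun k => ?_, by simp [smul_smul, hq0.ne']⟩
    have h1 : (q : ℝ) • z = ∑ i, ((q : ℝ) * c i) • v i := by
      simp only [z, Finset.smul_sum, smul_smul]
    rw [h1, coord_sum_smul, ← Finset.mul_sum, hcsum]
    have h2 : 0 < v.coord k 0 / q + (c k - N * v.coord k 0) := by
      by_cases hk : (k : ℕ) < j
      · have := (abs_lt.1 (ha ⟨k, hk⟩)).1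
        simp only [originCoord_val] at this
        simp only [c, dif_pos hk]
        linarith
      · simp only [c, dif_neg hk, Int.cast_zero, zero_sub]
        have h3 := hpos k
        have h4 := mul_nonneg (neg_nonneg.2 hN) h3.le
        have h5 := div_pos h3 hq0
        linarith
    calc 0 < q * (v.coord k 0 / q + (c k - N * v.coord k 0)) := mul_pos hq0 h2
      _ = _ := by field_simp
  have hz0 : z = 0 := by
    have : z ∈ ({0} : Set (Fin d → ℝ)) := hlc ▸ ⟨hzint, hzlat⟩
    simpa using this
  have hck (k : Fin (d + 1)) : (c k : ℝ) = N * v.coord k 0 := by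
    have := coord_sum_smul v (fun i => (c i : ℝ)) k
    rw [show ∑ i, (c i : ℝ) • v i = 0 from hz0, hcsum] at this
    linarith
  -- Linear relations among the vertices are proportional to `b`, all of whose entries are positive,
  -- whereas the last coefficient here is zero.
  have hN0 : N = 0 := by
    have h1 := hck (Fin.last d)
    have h2 : c (Fin.last d) = 0 := dif_neg (by simp; omega)
    rw [h2, Int.cast_zero, eq_comm, mul_eq_zero] at h1
    exact h1.resolve_right (hpos _).ne'
  refine ha0 (funext fun i => ?_)
  have := hck ⟨i, by omega⟩
  rw [hN0, zero_mul] at this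
  simpa [c] using this

/-- The matrix whose rows are all the vertices but the last one. -/
def vertexMatrix (v : AffineBasis (Fin (d + 1)) ℝ (Fin d → ℝ)) : Matrix (Fin d) (Fin d) ℝ :=
  Matrix.of fun i => v i.castSucc

theorem det_vertexMatrix_ne_zero (hpos : ∀ i, 0 < v.coord i 0) : (vertexMatrix v).det ≠ 0 := by
  intro hdet
  obtain ⟨a, ha0, ha⟩ := Matrix.exists_vecMul_eq_zero_iff.2 hdet
  let c : Fin (d + 1) → ℝ := Fin.snoc a 0
  have hz : ∑ i, c i • v i = 0 := by
    rw [Fin.sum_univ_castSucc]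
    simp only [c, Fin.snoc_castSucc, Fin.snoc_last, zero_smul, add_zero]
    rw [← ha]
    ext k
    simp [Matrix.vecMul, dotProduct, vertexMatrix]
  have hck (k : Fin (d + 1)) : c k = (∑ i, c i) * v.coord k 0 := by
    have := coord_sum_smul v c k
    rw [hz] at this
    linarith
  have hN : ∑ i, c i = 0 := by
    have h1 := hck (Fin.last d)
    rw [show c (Fin.last d) = 0 from Fin.snoc_last _ _, eq_comm, mul_eq_zero] at h1
    exact h1.resolve_right (hpos _).ne'
  refine ha0 (funext fun i => ?_)
  have := hck i.castSucc
  rw [hN, zero_mul] at this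
  simpa [c] using this

/-- The inequalities from the first `d` vertices are the orthant conditions. Since `∑ b i * ⟨m, v i⟩
= 0`, the one from the last vertex becomes the bound by `1` on the weighted sum. -/
theorem dual_eq_preimage (hpos : ∀ i, 0 < v.coord i 0) :
    dual (convexHull ℝ (Set.range v)) =
      (fun m => (vertexMatrix v).mulVec m + 1) ⁻¹'
        cornerSimplex fun i : Fin d => v.coord i.castSucc 0 := by
  ext m
  have h1 : m ∈ dual (convexHull ℝ (Set.range v)) ↔ ∀ i, 0 ≤ m ⬝ᵥ v i + 1 := by
    constructor
    · exact fun h i => h _ (subset_convexHull ℝ _ ⟨i, rfl⟩)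
    · intro h x hx
      have hconv : Convex ℝ {x : Fin d → ℝ | 0 ≤ m ⬝ᵥ x + 1} := by
        intro x hx y hy s t hs ht hst
        simp only [Set.mem_ofPred_eq] at hx hy ⊢
        rw [dotProduct_add, dotProduct_smul, dotProduct_smul, smul_eq_mul, smul_eq_mul]
        calc 0 ≤ s * (m ⬝ᵥ x + 1) + t * (m ⬝ᵥ y + 1) := by positivity
          _ = s * (m ⬝ᵥ x) + t * (m ⬝ᵥ y) + (s + t) := by ring
          _ = _ := by rw [hst]
      exact convexHull_min (by rintro _ ⟨i, rfl⟩; exact h i) hconv hx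
  have hrow (i : Fin d) : ((vertexMatrix v).mulVec m + 1) i = m ⬝ᵥ v i.castSucc + 1 := by
    simp [Matrix.mulVec, vertexMatrix, dotProduct_comm]
  have hlast : ∑ i : Fin d, v.coord i.castSucc 0 * (m ⬝ᵥ v i.castSucc + 1) =
      1 - v.coord (Fin.last d) 0 * (m ⬝ᵥ v (Fin.last d) + 1) := by
    have h2 : ∑ i, v.coord i 0 * (m ⬝ᵥ v i) = 0 := by
      have h := congrArg (m ⬝ᵥ ·) (v.linear_combination_coord_eq_self 0)
      simp only [dotProduct_sum, dotProduct_smul, smul_eq_mul, dotProduct_zero] at h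
      exact h
    have h3 := v.sum_coord_apply_eq_one 0
    rw [Fin.sum_univ_castSucc] at h2 h3
    simp only [mul_add, mul_one, Finset.sum_add_distrib]
    linarith
  rw [h1, Fin.forall_fin_succ']
  simp only [cornerSimplex, Set.mem_preimage, Set.mem_ofPred_eq, hrow, hlast]
  refine and_congr_right fun _ => ?_
  rw [sub_le_self_iff, mul_nonneg_iff_of_pos_left (hpos _)]

open MeasureTheory in
theorem normalizedVol_dual (hpos : ∀ i, 0 < v.coord i 0) :
    normalizedVol (dual (convexHull ℝ (Set.range v))) =
      ENNReal.ofReal ((∏ i ∈ Finset.range d, originCoord v i) * |(vertexMatrix v).det|)⁻¹ := by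
  have hdet := det_vertexMatrix_ne_zero hpos
  have hprod : ∏ i : Fin d, v.coord i.castSucc 0 = ∏ i ∈ Finset.range d, originCoord v i := by
    rw [← Fin.prod_univ_eq_prod_range]
    exact Finset.prod_congr rfl fun i _ => (originCoord_val v i.castSucc).symm
  have hpre : dual (convexHull ℝ (Set.range v)) = Matrix.toLin' (vertexMatrix v) ⁻¹'
      ((fun x => x + 1) ⁻¹' cornerSimplex fun i : Fin d => v.coord i.castSucc 0) := by
    rw [dual_eq_preimage hpos]; rfl
  have hvol := normalizedVol_cornerSimplex (β := fun i : Fin d => v.coord i.castSucc 0)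
    fun i => hpos _
  rw [normalizedVol] at hvol
  rw [normalizedVol, hpre, Measure.addHaar_preimage_linearMap _ (by rwa [LinearMap.det_toLin']),
    measure_preimage_add_right, LinearMap.det_toLin', mul_left_comm, hvol, hprod,
    ← ENNReal.ofReal_mul (abs_nonneg _), abs_inv, ← mul_inv, mul_comm]

theorem exists_int_vertexMatrix (hint : ∀ i, v i ∈ lattice d) :
    ∃ A : Matrix (Fin d) (Fin d) ℤ, vertexMatrix v = A.map (Int.cast : ℤ → ℝ) ∧
      (vertexMatrix v).det = (A.det : ℝ) := by
  choose w hw using hint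
  have h : vertexMatrix v = (Matrix.of fun i : Fin d => w i.castSucc).map (Int.cast : ℤ → ℝ) := by
    ext i j
    simp [vertexMatrix, ← hw]
  refine ⟨_, h, ?_⟩
  have := RingHom.map_det (Int.castRingHom ℝ) (Matrix.of fun i : Fin d => w i.castSucc)
  rw [h]
  exact this.symm

theorem one_le_abs_det_vertexMatrix (hpos : ∀ i, 0 < v.coord i 0) (hint : ∀ i, v i ∈ lattice d) :
    1 ≤ |(vertexMatrix v).det| := by
  obtain ⟨A, -, hA⟩ := exists_int_vertexMatrix hint
  have hdet := det_vertexMatrix_ne_zero hpos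
  rw [hA] at hdet ⊢
  have : A.det ≠ 0 := by exact_mod_cast hdet
  exact_mod_cast Int.one_le_abs this

theorem unimodularEquiv_dual_cornerSimplex (hpos : ∀ i, 0 < v.coord i 0)
    (hint : ∀ i, v i ∈ lattice d) (hdet : |(vertexMatrix v).det| = 1) :
    UnimodularEquiv (dual (convexHull ℝ (Set.range v)))
      (cornerSimplex fun i : Fin d => v.coord i.castSucc 0) := by
  obtain ⟨A, hA, hA'⟩ := exists_int_vertexMatrix hint
  have hunit : IsUnit A.det := by
    rw [Int.isUnit_iff_abs_eq]
    rw [hA'] at hdet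
    exact_mod_cast hdet
  obtain ⟨f, hf, hfx⟩ := exists_affineEquiv_of_isUnit_det hunit 1
  refine ⟨f, hf, ?_⟩
  have : (fun m => (vertexMatrix v).mulVec m + 1) = f := by
    ext m : 1
    rw [hfx, hA]
    congr 1
    ext; simp
  rw [dual_eq_preimage hpos, this, Set.image_preimage_eq _ f.surjective]

end

/-- This is the pair `(d, q) = (2, 1)`. Here `y ≥ (1 - x) / 2` and `1/3 ≤ x ≤ 1/2`, a range on which
`x * (1 - x) / 2` is at least its value at `1/3`. -/
theorem one_div_nine_le_mul {x y z : ℝ} (hxy : y ≤ x) (hyz : z ≤ y) (hsum : x + y + z = 1)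
    (hx : x ≤ y + z) : 1 / 9 ≤ x * y := by
  have h1 : 1 / 3 ≤ x := by linarith
  have h2 : x * ((1 - x) / 2) ≤ x * y := by
    apply mul_le_mul_of_nonneg_left <;> linarith
  nlinarith

end FanoPolytope

/-! ### Assembly of the three statements -/

theorem theorem4p1 (d q : ℕ) (hd : 2 ≤ d) (hq : 1 ≤ q) (S : Set (Fin d → ℝ))
    (hS : FanoPolytope.IsSimplex S) (hlc : FanoPolytope.IsLcFano (1 / (q : ℝ)) S) :
    (d = 2 →
      (q = 1 → FanoPolytope.normalizedVol (FanoPolytope.dual S) ≤ 9) ∧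
      (2 ≤ q → FanoPolytope.normalizedVol (FanoPolytope.dual S) ≤
        ENNReal.ofReal (2 * (FanoPolytope.u q 2 : ℝ) ^ 2 / (q : ℝ) ^ 3))) ∧
    (3 ≤ d → FanoPolytope.normalizedVol (FanoPolytope.dual S) ≤
      ENNReal.ofReal (2 * (FanoPolytope.u q d : ℝ) ^ 2 / (q : ℝ) ^ (d + 1))) ∧
    (2 ≤ q →
      (FanoPolytope.UnimodularEquiv (FanoPolytope.dual S) (FanoPolytope.extremalSimplex d q) →
        FanoPolytope.normalizedVol (FanoPolytope.dual S) =
          ENNReal.ofReal (2 * (FanoPolytope.u q d : ℝ) ^ 2 / (q : ℝ) ^ (d + 1))) ∧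
      (¬(d = 2 ∧ q = 2) →
        FanoPolytope.normalizedVol (FanoPolytope.dual S) =
          ENNReal.ofReal (2 * (FanoPolytope.u q d : ℝ) ^ 2 / (q : ℝ) ^ (d + 1)) →
        FanoPolytope.UnimodularEquiv (FanoPolytope.dual S)
          (FanoPolytope.extremalSimplex d q))) := by
  open FanoPolytope in
  obtain ⟨-, ⟨-, hvert, h0, -⟩, hlc⟩ := hlc
  obtain ⟨v, rfl, hv, hanti, hpos⟩ := exists_affineBasis hS h0
  have hint (i : Fin (d + 1)) : v i ∈ lattice d := hvert (hv ▸ ⟨i, rfl⟩)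
  have hq0 : (0 : ℝ) < q := by exact_mod_cast hq
  have hu := u_cast_pos hq (by omega : 1 ≤ d)
  -- Indices beyond `d` are clamped to `d`, so the extension to `ℕ` stays decreasing and positive.
  have hb : Antitone (originCoord v) := fun m n h => hanti (by
    rw [Fin.mk_le_mk]; exact min_le_min_right d h)
  have hbpos (n : ℕ) : 0 < originCoord v n := hpos _
  have hC := fun j (hj : j < d) => prod_le_of_lc hq hpos hint hlc hj
  have hD := one_le_abs_det_vertexMatrix hpos hint
  set P := ∏ i ∈ Finset.range d, originCoord v i with hP
  have hP0 : 0 < P := Finset.prod_pos fun i _ => hbpos i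
  have hvol := normalizedVol_dual hpos
  rw [← hP] at hvol
  have hinv : 2 * (u q d : ℝ) ^ 2 / (q : ℝ) ^ (d + 1) =
      ((q : ℝ) ^ (d + 1) / (2 * (u q d : ℝ) ^ 2))⁻¹ := (inv_div _ _).symm
  have hle {y : ℝ} (hy : 0 < y) (hyP : y ≤ P) :
      normalizedVol (dual (convexHull ℝ (Set.range v))) ≤ ENNReal.ofReal y⁻¹ := by
    rw [hvol]
    refine ENNReal.ofReal_le_ofReal (inv_anti₀ hy (hyP.trans ?_))
    exact le_mul_of_one_le_right hP0.le hD
  have hmain (h : ¬ (d = 2 ∧ q = 1)) : normalizedVol (dual (convexHull ℝ (Set.range v))) ≤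
      ENNReal.ofReal (2 * (u q d : ℝ) ^ 2 / (q : ℝ) ^ (d + 1)) := by
    rw [hinv]
    exact hle (by positivity) (prod_ge hq (by omega) h hb hbpos hC)
  have hT : normalizedVol (extremalSimplex d q) =
      ENNReal.ofReal (2 * (u q d : ℝ) ^ 2 / (q : ℝ) ^ (d + 1)) := by
    rw [← (unimodularEquiv_cornerSimplex_extremalSimplex (by omega) hq).normalizedVol_eq,
      normalizedVol_cornerSimplex (extremalWeight_pos (by omega) hq),
      prod_extremalWeight (by omega) hq, hinv]
  refine ⟨?_, fun h => hmain (by omega), fun hq2 => ⟨fun h => h.normalizedVol_eq.trans hT, ?_⟩⟩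
  · rintro rfl
    refine ⟨?_, fun h => hmain (by omega)⟩
    rintro rfl
    have h1 := hC 1 (by norm_num)
    have h2 := sum_originCoord v
    simp only [Finset.sum_Ico_eq_sum_range, Finset.sum_range_succ, Finset.prod_range_succ,
      Finset.sum_range_zero, Finset.prod_range_zero] at h1 h2
    norm_num at h1 h2
    have h3 : 1 / 9 ≤ P := by
      rw [hP, Finset.prod_range_succ, Finset.prod_range_one]
      exact one_div_nine_le_mul (hb (by norm_num)) (hb (by norm_num)) h2 h1
    convert hle (by norm_num) h3
    norm_num
  · intro hdq heq
    rw [hvol, hinv, ENNReal.ofReal_eq_ofReal_iff (by positivity) (by positivity), inv_inj] at heq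
    have h1 := prod_ge hq (by omega) (by omega) hb hbpos hC
    rw [← heq, ← hP] at h1
    -- The product `P` is at least the target and `P * |det|` equals it, so the determinant is a
    -- unit and `P` is extremal.
    have hD1 : |(vertexMatrix v).det| = 1 := by
      refine le_antisymm (le_of_mul_le_mul_left ?_ hP0) hD
      rwa [mul_one]
    rw [hD1, mul_one] at heq
    obtain ⟨h2, h3, -⟩ := eq_of_prod_eq hq2 (by omega) hdq hb hbpos hC heq
    have h4 : (fun i : Fin d => v.coord i.castSucc 0) = extremalWeight d q := by
      ext i
      rw [← originCoord_val, Fin.val_castSucc, extremalWeight]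
      split_ifs with hi
      · exact h2 i hi
      · rw [show (i : ℕ) = d - 1 by omega, h3]
    have h5 := unimodularEquiv_dual_cornerSimplex hpos hint hD1
    rw [h4] at h5
    exact h5.trans (unimodularEquiv_cornerSimplex_extremalSimplex (by omega) hq)
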